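/- A \emph{polytope} is the convex hull of a finite set of points in some $\mathbb{R}^n$, and a \emph{$d$-polytope} is a nonempty polytope whose affine hull has dimension $d$. A \emph{cubical $d$-polytope} is a $d$-polytope each of whose facets is a $(d-1)$-cube, that is, has face lattice isomorphic to the face lattice of $[0,1]^{d-1}$. The \emph{graph} of a polytope is the undirected graph formed by its vertices and edges. A graph is \emph{$k$-linked} if it has at least $2k$ vertices and, for every set of exactly $2k$ vertices and every partition of this set into unordered pairs $\{s_1,t_1\},\dots,\{s_k,t_k\}$, there are pairwise vertex-disjoint paths $L_1,\dots,L_k$ in the graph such that $L_i$ joins $s_i$ to $t_i$ for each $i$; a polytope is $k$-linked if its graph is. \textbf{Proposition.} For every $d\ge 1$, every cubical $d$-polytope is $\lfloor d/2\rfloor$-linked. -/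

import Mathlib

section LinkedGraphs

/-- A graph `G` is `k`-linked if it has at least `2k` vertices and, for any `2k` distinct vertices
`s 0, …, s (k-1), t 0, …, t (k-1)`, there are pairwise vertex-disjoint paths joining `s i` to `t i`
for all `i`. (The families `s`, `t` range over all labelled pairings of all sets of exactly `2k`
vertices.) -/
def SimpleGraph.IsLinked {V : Type*} (G : SimpleGraph V) (k : ℕ) : Prop :=
  ((2 * k : ℕ) : ℕ∞) ≤ ENat.card V ∧
    ∀ s t : Fin k → V, Function.Injective (Sum.elim s t) →
      ∃ p : ∀ i, G.Path (s i) (t i),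
        Pairwise fun i j => List.Disjoint (p i).1.support (p j).1.support

end LinkedGraphs

namespace Polytope

/-- A (convex) polytope is the convex hull of a finite set of points. -/
def IsPolytope {E : Type*} [AddCommGroup E] [Module ℝ E] (P : Set E) : Prop :=
  ∃ S : Finset E, P = convexHull ℝ (S : Set E)

/-- The dimension of the affine hull of `P` (with value `0` at the empty set, which is excluded
wherever this is used). -/
noncomputable def dim {E : Type*} [AddCommGroup E] [Module ℝ E] (P : Set E) : ℕ :=
  Module.finrank ℝ (vectorSpan ℝ P)

variable {E : Type*} [AddCommGroup E] [Module ℝ E] [TopologicalSpace E]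

/-- The face lattice of `P`: the sets of maximisers on `P` of continuous linear functionals,
together with the empty face, ordered by inclusion. (The zero functional gives the face `P`.) -/
abbrev FaceLattice (P : Set E) : Type _ :=
  {F : Set E // IsExposed ℝ P F}

/-- Two polytopes are combinatorially equivalent if their face lattices are isomorphic. -/
def CombEquiv {E' : Type*} [AddCommGroup E'] [Module ℝ E'] [TopologicalSpace E']
    (P : Set E) (Q : Set E') : Prop :=
  Nonempty (FaceLattice P ≃o FaceLattice Q)

/-- The geometric cube `[0, 1]^m` in `ℝ^m`. -/
def unitCube (m : ℕ) : Set (Fin m → ℝ) :=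
  Set.Icc 0 1

/-- A facet of `P` is a nonempty face of dimension `dim P - 1`. -/
def IsFacet (P F : Set E) : Prop :=
  IsExposed ℝ P F ∧ F.Nonempty ∧ dim F + 1 = dim P

/-- A cubical `d`-polytope: a nonempty polytope of dimension `d`, each facet `F` of which is
combinatorially equivalent to the cube of dimension `dim F`. -/
structure IsCubicalPolytope (d : ℕ) (P : Set E) : Prop where
  isPolytope : IsPolytope P
  nonempty : P.Nonempty
  dim_eq : dim P = d
  cubical : ∀ F : Set E, IsFacet P F → CombEquiv F (unitCube (dim F))

/-- The graph of `P`: its vertices are the points `v` such that `{v}` is a face of `P`, and two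
distinct vertices are adjacent when the segment between them is a face (that is, an edge)
of `P`. -/
def graph (P : Set E) : SimpleGraph (P.exposedPoints ℝ) where
  Adj v w := v ≠ w ∧ IsExposed ℝ P (segment ℝ (v : E) (w : E))
  symm := ⟨fun v w h => ⟨h.1.symm, segment_symm ℝ (v : E) (w : E) ▸ h.2⟩⟩
  loopless := ⟨fun _ h => h.1 rfl⟩

end Polytope

namespace SimpleGraph

/-! ### Walks confined to vertex sets, and Menger's theorem. -/

variable {V W : Type*} {G H : SimpleGraph V} {D D' : Set V} {x y z : V}

/-- `G.JoinedIn D x y` means that some walk of `G` from `x` to `y` has all its vertices in `D`. -/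
def JoinedIn (G : SimpleGraph V) (D : Set V) (x y : V) : Prop :=
  x ∈ D ∧ Relation.ReflTransGen (fun u v => G.Adj u v ∧ v ∈ D) x y

theorem JoinedIn.refl (h : x ∈ D) : G.JoinedIn D x x := ⟨h, .refl⟩

theorem JoinedIn.left_mem (h : G.JoinedIn D x y) : x ∈ D := h.1

theorem JoinedIn.right_mem (h : G.JoinedIn D x y) : y ∈ D := by
  obtain ⟨hx, h⟩ := h
  induction h with
  | refl => exact hx
  | tail _ h _ => exact h.2

theorem JoinedIn.trans (h : G.JoinedIn D x y) (h' : G.JoinedIn D y z) : G.JoinedIn D x z :=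
  ⟨h.1, h.2.trans h'.2⟩

theorem JoinedIn.of_adj (h : G.Adj x y) (hx : x ∈ D) (hy : y ∈ D) : G.JoinedIn D x y :=
  ⟨hx, .single ⟨h, hy⟩⟩

theorem JoinedIn.head (h : G.Adj x y) (hx : x ∈ D) (h' : G.JoinedIn D y z) : G.JoinedIn D x z :=
  (JoinedIn.of_adj h hx h'.1).trans h'

theorem JoinedIn.mono (hGH : G ≤ H) (hD : D ⊆ D') (h : G.JoinedIn D x y) : H.JoinedIn D' x y :=
  ⟨hD h.1, h.2.lift id fun _ _ h => ⟨hGH h.1, hD h.2⟩⟩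

theorem JoinedIn.mono_set (hD : D ⊆ D') (h : G.JoinedIn D x y) : G.JoinedIn D' x y :=
  h.mono le_rfl hD

/-- Induction on a walk, adding edges at its start. -/
theorem JoinedIn.head_induction {motive : V → Prop} (h : G.JoinedIn D x y)
    (refl : y ∈ D → motive y)
    (head : ∀ a c, G.Adj a c → a ∈ D → G.JoinedIn D c y → motive c → motive a) : motive x := by
  have hy := h.right_mem
  obtain ⟨hx, h⟩ := h
  revert hx
  induction h using Relation.ReflTransGen.head_induction_on with
  | refl => exact fun _ => refl hy
  | head h1 h2 ih => exact fun ha => head _ _ h1.1 ha ⟨h1.2, h2⟩ (ih h1.2)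

theorem JoinedIn.symm (h : G.JoinedIn D x y) : G.JoinedIn D y x :=
  h.head_induction (motive := fun a => G.JoinedIn D y a) (fun hy => .refl hy)
    fun _ _ hac ha _ ih => ih.trans (.of_adj hac.symm ih.right_mem ha)

theorem JoinedIn.map {G' : SimpleGraph W} {f : V → W} {D' : Set W}
    (hf : ∀ u v, G.Adj u v → G'.Adj (f u) (f v)) (hD : ∀ u ∈ D, f u ∈ D')
    (h : G.JoinedIn D x y) : G'.JoinedIn D' (f x) (f y) :=
  ⟨hD _ h.1, h.2.lift f fun _ _ h => ⟨hf _ _ h.1, hD _ h.2⟩⟩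

theorem JoinedIn.exists_path (h : G.JoinedIn D x y) :
    ∃ p : G.Path x y, ∀ z ∈ p.1.support, z ∈ D := by
  classical
  obtain ⟨p, hp⟩ : ∃ p : G.Walk x y, ∀ z ∈ p.support, z ∈ D := by
    refine h.head_induction (motive := fun a => ∃ p : G.Walk a y, ∀ z ∈ p.support, z ∈ D)
      (fun hy => ⟨.nil, by simpa using hy⟩) ?_
    rintro a c hac ha - ⟨p, hp⟩
    exact ⟨.cons hac p, by simpa using ⟨ha, hp⟩⟩
  exact ⟨p.toPath, fun z hz => hp z (p.support_toPath_subset_support hz)⟩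

/-- A walk that is not inside the complement of `B` can be cut off when it first meets `B`. -/
theorem JoinedIn.first_hit (B : Set V) (h : G.JoinedIn D x y) :
    G.JoinedIn (D \ B) x y ∨ ∃ b ∈ B, ∃ D' ⊆ D, G.JoinedIn D' x b ∧ (∀ z ∈ D', z ∈ B → z = b) ∧
      ∀ z ∈ D', z ≠ b → G.JoinedIn (D' \ {b}) x z := by
  have start : ∀ a ∈ B, a ∈ D → ∃ b ∈ B, ∃ D' ⊆ D, G.JoinedIn D' a b ∧
      (∀ z ∈ D', z ∈ B → z = b) ∧ ∀ z ∈ D', z ≠ b → G.JoinedIn (D' \ {b}) a z :=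
    fun a haB haD => ⟨a, haB, {a}, by simpa using haD, .refl rfl, fun z hz _ => hz,
      fun z hz hne => absurd hz hne⟩
  refine h.head_induction (motive := fun a => G.JoinedIn (D \ B) a y ∨ ∃ b ∈ B, ∃ D' ⊆ D,
    G.JoinedIn D' a b ∧ (∀ z ∈ D', z ∈ B → z = b) ∧
      ∀ z ∈ D', z ≠ b → G.JoinedIn (D' \ {b}) a z) (fun hy => ?_) ?_
  · by_cases hB : y ∈ B
    · exact .inr (start y hB hy)
    · exact .inl (.refl ⟨hy, hB⟩)
  · rintro a c hac ha - ih
    by_cases hB : a ∈ B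
    · exact .inr (start a hB ha)
    rcases ih with ih | ⟨b, hb, D', hD', hcb, hone, hreach⟩
    · exact .inl (ih.head hac ⟨ha, hB⟩)
    have hab : a ≠ b := fun h => hB (h ▸ hb)
    refine .inr ⟨b, hb, insert a D', Set.insert_subset ha hD',
      (hcb.mono_set (Set.subset_insert _ _)).head hac (Set.mem_insert _ _), ?_, ?_⟩
    · rintro z (rfl | hz) hzB
      exacts [absurd hzB hB, hone z hz hzB]
    · rintro z (rfl | hz) hzb
      · exact .refl ⟨Set.mem_insert _ _, hab⟩
      · exact ((hreach z hz hzb).mono_set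
          (Set.sdiff_subset_sdiff_left (Set.subset_insert _ _))).head hac ⟨Set.mem_insert _ _, hab⟩

/-- Only the piece before the first crossing of the edge and the piece after the last crossing are
kept. If they meet at the same end of the edge, they join up without it. -/
theorem JoinedIn.deleteEdge {u v : V} (h : G.JoinedIn D x y) :
    (G.deleteEdges {s(u, v)}).JoinedIn D x y ∨
    ((G.deleteEdges {s(u, v)}).JoinedIn D x u ∧ (G.deleteEdges {s(u, v)}).JoinedIn D v y) ∨
    ((G.deleteEdges {s(u, v)}).JoinedIn D x v ∧ (G.deleteEdges {s(u, v)}).JoinedIn D u y) := by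
  set G' := G.deleteEdges {s(u, v)} with hG'
  refine h.head_induction (motive := fun a => G'.JoinedIn D a y ∨
    (G'.JoinedIn D a u ∧ G'.JoinedIn D v y) ∨ (G'.JoinedIn D a v ∧ G'.JoinedIn D u y))
    (fun hy => .inl (.refl hy)) ?_
  rintro a c hac ha - ih
  by_cases he : s(a, c) = s(u, v)
  · rcases Sym2.eq_iff.1 he with ⟨rfl, rfl⟩ | ⟨rfl, rfl⟩
    · rcases ih with ih | ⟨-, ih⟩ | ⟨-, ih⟩
      exacts [.inr (.inl ⟨.refl ha, ih⟩), .inr (.inl ⟨.refl ha, ih⟩), .inl ih]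
    · rcases ih with ih | ⟨-, ih⟩ | ⟨-, ih⟩
      exacts [.inr (.inr ⟨.refl ha, ih⟩), .inl ih, .inr (.inr ⟨.refl ha, ih⟩)]
  · have hac' : G'.Adj a c := by
      rw [hG', deleteEdges_adj]
      exact ⟨hac, he⟩
    rcases ih with ih | ⟨ih, h2⟩ | ⟨ih, h2⟩
    exacts [.inl (ih.head hac' ha), .inr (.inl ⟨ih.head hac' ha, h2⟩),
      .inr (.inr ⟨ih.head hac' ha, h2⟩)]

/-- `S` meets every walk from `A` to `B`. -/
def Separates (G : SimpleGraph V) (S A B : Set V) : Prop :=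
  ∀ a ∈ A, ∀ b ∈ B, ¬ G.JoinedIn Sᶜ a b

theorem Separates.symm {S A B : Set V} (h : G.Separates S A B) : G.Separates S B A :=
  fun b hb a ha hab => h a ha b hb hab.symm

/-- There are `n` pairwise disjoint walks from `A` to `B`. -/
def HasDisjointWalks (G : SimpleGraph V) (A B : Set V) (n : ℕ) : Prop :=
  ∃ (a b : Fin n → V) (D : Fin n → Set V), (∀ i, a i ∈ A) ∧ (∀ i, b i ∈ B) ∧
    (∀ i, G.JoinedIn (D i) (a i) (b i)) ∧ Pairwise fun i j => Disjoint (D i) (D j)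

/-- Disjoint walks from `A` to a set `P` of exactly `n` vertices, indexed by their ends. -/
theorem HasDisjointWalks.indexed {A : Set V} {P : Finset V} {n : ℕ}
    (h : G.HasDisjointWalks A P n) (hP : P.card = n) :
    ∃ (a : V → V) (D : V → Set V), (∀ p ∈ P, a p ∈ A ∧ G.JoinedIn (D p) (a p) p) ∧
      ∀ p ∈ P, ∀ q ∈ P, p ≠ q → Disjoint (D p) (D q) := by
  obtain ⟨a, b, D, ha, hb, hab, hD⟩ := h
  have hinj : Function.Injective b := fun i j hij => by
    by_contra hne
    exact Set.disjoint_left.1 (hD hne) (hab i).right_mem (hij ▸ (hab j).right_mem)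
  have hsurj : ∀ p ∈ P, ∃ i, b i = p := fun p hp => by
    obtain ⟨i, -, hi⟩ := Finset.surj_on_of_inj_on_of_card_le (s := Finset.univ) (t := P)
      (fun i _ => b i) (fun i _ => hb i) (fun i j _ _ h => hinj h) (by simp [hP]) p hp
    exact ⟨i, hi.symm⟩
  rcases P.eq_empty_or_nonempty with rfl | ⟨p₀, hp₀⟩
  · exact ⟨id, fun _ => ∅, by simp, by simp⟩
  have : Nonempty (Fin n) := ⟨(hsurj p₀ hp₀).choose⟩
  choose! i hi using hsurj
  refine ⟨fun p => a (i p), fun p => D (i p), fun p hp => ⟨ha _, ?_⟩, fun p hp q hq hpq => ?_⟩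
  · simpa [hi p hp] using hab (i p)
  · exact hD fun h => hpq (by rw [← hi p hp, ← hi q hq, h])

/-- One half of the inductive step in Menger's theorem: the part of the walks on the side of `A`. -/
theorem exists_walks_to_separator {A B : Set V} {S : Finset V} {x y : V} {n : ℕ}
    [DecidableEq V]
    (ih : ∀ B : Set V, (∀ S : Finset V, (G.deleteEdges {s(x, y)}).Separates S A B → n ≤ S.card) →
      (G.deleteEdges {s(x, y)}).HasDisjointWalks A B n)
    (hsep : ∀ S : Finset V, G.Separates S A B → n ≤ S.card)
    (hS : (G.deleteEdges {s(x, y)}).Separates S A B) (hxS : x ∉ S)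
    (hn : (insert x S).card = n)
    {b : V} (hb : b ∈ B) (hyb : (G.deleteEdges {s(x, y)}).JoinedIn (S : Set V)ᶜ y b) :
    ∃ (a : V → V) (D : V → Set V), (∀ p ∈ insert x S, a p ∈ A ∧
        (G.deleteEdges {s(x, y)}).JoinedIn (D p) (a p) p ∧ ∀ z ∈ D p, z ≠ p →
          ∃ a ∈ A, (G.deleteEdges {s(x, y)}).JoinedIn (S : Set V)ᶜ a z) ∧
      ∀ p ∈ insert x S, ∀ q ∈ insert x S, p ≠ q → Disjoint (D p) (D q) := by
  set G' := G.deleteEdges {s(x, y)} with hG'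
  set P : Finset V := insert x S with hP
  have hSP : (P : Set V)ᶜ ⊆ (S : Set V)ᶜ := by
    intro z hz hzS
    exact hz (by simp [hP, Finset.mem_coe.1 hzS])
  have hxP : x ∈ (P : Set V) := by simp [hP]
  have hPsep : G.Separates P A B := by
    intro a ha b hb hab
    rcases hab.deleteEdge (u := x) (v := y) with h | ⟨h, -⟩ | ⟨-, h⟩
    · exact hS a ha b hb (h.mono_set hSP)
    · exact h.right_mem hxP
    · exact h.left_mem hxP
  -- A set `T` separating `A` from `P` without the edge also separates `A` from `B` with it. A walk
  -- to `B` avoiding `T` first meets `P` somewhere; if its initial piece needed the edge from `y` to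
  -- `x`, then `A` would reach `y`, hence `b`, outside `S`.
  have key : G'.HasDisjointWalks A P n := by
    refine ih P fun T hT => hsep T fun a ha b' hb' hab => ?_
    rcases hab.first_hit P with h | ⟨p, hp, D', hD', h, hone, -⟩
    · exact hPsep a ha b' hb' (h.mono_set fun z hz => hz.2)
    rcases h.deleteEdge (u := x) (v := y) with h | ⟨h, -⟩ | ⟨h, h2⟩
    · exact hT a ha p hp (h.mono_set hD')
    · exact hT a ha x hxP (h.mono_set hD')
    · have hpx : x = p := hone x h2.left_mem hxP
      refine hS a ha b hb (JoinedIn.trans (h.mono_set fun z hz hzS => ?_) hyb)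
      have := hone z hz (by simp [hP, Finset.mem_coe.1 hzS])
      exact hxS (by rw [hpx, ← this]; exact hzS)
  obtain ⟨a, D, h1, h2⟩ := key.indexed hn
  have h3 : ∀ p ∈ P, ∃ D' ⊆ D p, G'.JoinedIn D' (a p) p ∧ ∀ z ∈ D', z ≠ p →
      ∃ a ∈ A, G'.JoinedIn (S : Set V)ᶜ a z := by
    intro p hp
    have hDP : ∀ q ∈ P, q ∈ D p → q = p := fun q hq hqD => by
      by_contra hne
      exact Set.disjoint_left.1 (h2 q hq p hp hne) (h1 q hq).2.right_mem hqD
    rcases (h1 p hp).2.first_hit P with h | ⟨q, hq, D', hD', h, -, hreach⟩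
    · exact absurd hp h.right_mem.2
    obtain rfl : q = p := hDP q hq (hD' h.right_mem)
    refine ⟨D', hD', h, fun z hz hzq => ⟨a q, (h1 q hp).1, (hreach z hz hzq).mono_set ?_⟩⟩
    intro w hw hwS
    exact hw.2 (hDP w (by simp [hP, Finset.mem_coe.1 hwS]) (hD' hw.1))
  choose! D' hD' h4 h5 using h3
  exact ⟨a, D', fun p hp => ⟨(h1 p hp).1, h4 p hp, h5 p hp⟩,
    fun p hp q hq hpq => (h2 p hp q hq hpq).mono (hD' p hp) (hD' q hq)⟩

/-- **Menger's theorem**. -/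
theorem hasDisjointWalks_of_separates [Finite V] (n : ℕ) (A B : Set V)
    (hsep : ∀ S : Finset V, G.Separates S A B → n ≤ S.card) : G.HasDisjointWalks A B n := by
  classical
  have := Fintype.ofFinite V
  induction G using WellFoundedLT.induction generalizing A B with
  | ind G ih =>
  by_cases hbot : ∀ x y, ¬ G.Adj x y
  · have hcard : n ≤ (Finset.univ.filter fun v => v ∈ A ∩ B).card := by
      refine hsep _ fun a ha b hb hab => ?_
      refine hab.head_induction (motive := fun a => a ∈ A → False) (fun hb' ha' => ?_)
        (fun a c hac _ _ _ _ => hbot a c hac) ha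
      exact hb' (by simp [ha', hb])
    obtain ⟨T, hT, hTn⟩ := Finset.exists_subset_card_eq hcard
    have e := (Finset.equivFinOfCardEq hTn).symm
    have hmem : ∀ i, (e i : V) ∈ A ∩ B := fun i => (Finset.mem_filter.1 (hT (e i).2)).2
    refine ⟨fun i => e i, fun i => e i, fun i => {(e i : V)}, fun i => (hmem i).1,
      fun i => (hmem i).2, fun i => .refl rfl, fun i j hij => ?_⟩
    simpa [Subtype.ext_iff] using fun h => hij (e.injective (Subtype.ext h))
  push Not at hbot
  obtain ⟨x, y, hxy⟩ := hbot
  have hlt : ∀ x y, G.Adj x y → G.deleteEdges {s(x, y)} < G := fun x y hxy => by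
    refine lt_of_le_of_ne (deleteEdges_le _) fun h => ?_
    rw [← h, deleteEdges_adj] at hxy
    exact hxy.2 rfl
  by_cases hG' : ∀ S : Finset V, (G.deleteEdges {s(x, y)}).Separates S A B → n ≤ S.card
  · obtain ⟨a, b, D, ha, hb, hab, hD⟩ := ih _ (hlt x y hxy) A B hG'
    exact ⟨a, b, D, ha, hb, fun i => (hab i).mono (deleteEdges_le _) le_rfl, hD⟩
  push Not at hG'
  obtain ⟨S, hS, hSn⟩ := hG'
  obtain ⟨a₀, ha₀, b₀, hb₀, hab₀⟩ : ∃ a ∈ A, ∃ b ∈ B, G.JoinedIn (S : Set V)ᶜ a b := by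
    by_contra! h
    exact absurd (hsep S h) (by omega)
  -- The edge is oriented so that `x` lies on the side of `A` and `y` on the side of `B`. Both `S ∪
  -- {x}` and `S ∪ {y}` then separate `A` from `B` in `G`, and have exactly `n` elements.
  obtain ⟨x, y, hxy, hS, hax, hyb⟩ : ∃ x y, G.Adj x y ∧
      (G.deleteEdges {s(x, y)}).Separates S A B ∧
      (G.deleteEdges {s(x, y)}).JoinedIn (S : Set V)ᶜ a₀ x ∧
      (G.deleteEdges {s(x, y)}).JoinedIn (S : Set V)ᶜ y b₀ := by
    rcases hab₀.deleteEdge (u := x) (v := y) with h | ⟨h1, h2⟩ | ⟨h1, h2⟩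
    · exact absurd h (hS a₀ ha₀ b₀ hb₀)
    · exact ⟨x, y, hxy, hS, h1, h2⟩
    · exact ⟨y, x, hxy.symm, by rwa [Sym2.eq_swap], by rwa [Sym2.eq_swap],
        by rwa [Sym2.eq_swap]⟩
  set G' := G.deleteEdges {s(x, y)} with hG'
  have hxS : x ∉ S := hax.right_mem
  have hyS : y ∉ S := hyb.left_mem
  have hswap : G.deleteEdges {s(y, x)} = G' := by rw [hG', Sym2.eq_swap]
  have hcard : S.card + 1 = n := by
    refine le_antisymm (by omega) ?_
    rw [← Finset.card_insert_of_notMem hxS]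
    refine hsep _ fun a ha b hb hab => ?_
    have hsub : ((insert x S : Finset V) : Set V)ᶜ ⊆ (S : Set V)ᶜ := by
      simp
    have hxm : x ∈ ((insert x S : Finset V) : Set V) := by simp
    rcases hab.deleteEdge (u := x) (v := y) with h | ⟨h, -⟩ | ⟨-, h⟩
    · exact hS a ha b hb (h.mono_set hsub)
    · exact h.right_mem hxm
    · exact h.left_mem hxm
  obtain ⟨a, D, hD, hDD⟩ := exists_walks_to_separator (G := G) (y := y)
    (fun B h => ih _ (hlt x y hxy) A B h) hsep hS hxS
    (by rw [Finset.card_insert_of_notMem hxS, hcard]) hb₀ hyb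
  obtain ⟨b, E, hE, hEE⟩ := exists_walks_to_separator (G := G) (x := y) (y := x) (A := B) (B := A)
    (S := S) (n := n) (fun A' h => ih _ (hlt y x hxy.symm) B A' h)
    (fun S h => hsep S h.symm) (by rw [hswap]; exact hS.symm) hyS
    (by rw [Finset.card_insert_of_notMem hyS, hcard]) ha₀ (by rw [hswap]; exact hax.symm)
  rw [hswap] at hE
  have e := (Finset.equivFinOfCardEq (s := insert x S) (n := n)
    (by rw [Finset.card_insert_of_notMem hxS, hcard])).symm
  -- Walks ending at `p` continue with walks starting at `σ p`: at a vertex of `S` the two share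
  -- that vertex, and from `x` to `y` the deleted edge bridges the gap.
  set σ : V → V := fun p => if p = x then y else p with hσ
  have hσmem : ∀ p ∈ insert x S, σ p ∈ insert y S := by
    intro p hp
    by_cases h : p = x
    · simp [hσ, h]
    · simpa [hσ, h] using .inr (Finset.mem_of_mem_insert_of_ne hp h)
  have hσinj : ∀ p ∈ insert x S, ∀ q ∈ insert x S, σ p = σ q → p = q := by
    intro p hp q hq hpq
    by_cases h : p = x <;> by_cases h' : q = x
    · rw [h, h']
    · simp only [hσ, h, h', if_true, if_false] at hpq
      exact absurd (hpq ▸ Finset.mem_of_mem_insert_of_ne hq h') hyS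
    · simp only [hσ, h, h', if_true, if_false] at hpq
      exact absurd (hpq ▸ Finset.mem_of_mem_insert_of_ne hp h) hyS
    · simpa [hσ, h, h'] using hpq
  -- A common vertex in `S` is the end of both walks, which forces `p = q`. One outside `S` would
  -- connect `A` to `B` around `S` without the edge.
  have hcross : ∀ p ∈ insert x S, ∀ q ∈ insert x S, p ≠ q → Disjoint (D p) (E (σ q)) := by
    intro p hp q hq hpq
    rw [Set.disjoint_left]
    intro z hzD hzE
    have h1 : z = p ∨ ∃ a ∈ A, G'.JoinedIn (S : Set V)ᶜ a z :=
      or_iff_not_imp_left.2 ((hD p hp).2.2 z hzD)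
    have h2 : z = σ q ∨ ∃ b ∈ B, G'.JoinedIn (S : Set V)ᶜ b z :=
      or_iff_not_imp_left.2 ((hE _ (hσmem q hq)).2.2 z hzE)
    have h1' : z ∈ S ∨ ∃ a ∈ A, G'.JoinedIn (S : Set V)ᶜ a z := by
      rcases h1 with rfl | h1
      · rcases Finset.mem_insert.1 hp with rfl | hp
        exacts [.inr ⟨a₀, ha₀, hax⟩, .inl hp]
      · exact .inr h1
    have h2' : z ∈ S ∨ ∃ b ∈ B, G'.JoinedIn (S : Set V)ᶜ b z := by
      rcases h2 with rfl | h2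
      · rcases Finset.mem_insert.1 (hσmem q hq) with h | h
        exacts [.inr ⟨b₀, hb₀, by rw [h]; exact hyb.symm⟩, .inl h]
      · exact .inr h2
    rcases h1' with hz | ⟨a', ha', haz⟩
    · have hzp : z = p := h1.resolve_right fun ⟨_, _, h⟩ => h.right_mem hz
      have hzq : z = σ q := h2.resolve_right fun ⟨_, _, h⟩ => h.right_mem hz
      have hzx : z ≠ x := fun h => hxS (h ▸ hz)
      have : σ z = z := by simp [hσ, hzx]
      exact hpq (hσinj p hp q hq (by rw [← hzp, this, ← hzq]))
    · rcases h2' with hz | ⟨b', hb', hbz⟩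
      · exact haz.right_mem hz
      · exact hS a' ha' b' hb' (haz.trans hbz.symm)
  refine ⟨fun i => a (e i), fun i => b (σ (e i)), fun i => D (e i) ∪ E (σ (e i)),
    fun i => (hD _ (e i).2).1, fun i => (hE _ (hσmem _ (e i).2)).1, fun i => ?_,
    fun i j hij => ?_⟩
  · have h1 := ((hD _ (e i).2).2.1.mono (deleteEdges_le _) (Set.subset_union_left
      (t := E (σ (e i)))))
    have h2 := ((hE _ (hσmem _ (e i).2)).2.1.symm.mono (deleteEdges_le _)
      (Set.subset_union_right (s := D (e i))))
    by_cases h : (e i : V) = x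
    · have hy : σ (e i) = y := by simp [hσ, h]
      refine h1.trans (JoinedIn.trans (.of_adj ?_ h1.right_mem h2.left_mem) h2)
      rwa [hy, h]
    · have hy : σ (e i) = e i := by simp [hσ, h]
      exact h1.trans (by convert h2 using 1; exact hy.symm)
  · have hne : (e i : V) ≠ e j := fun h => hij (e.injective (Subtype.ext h))
    refine Set.disjoint_union_left.2 ⟨Set.disjoint_union_right.2 ⟨hDD _ (e i).2 _ (e j).2 hne,
      hcross _ (e i).2 _ (e j).2 hne⟩, Set.disjoint_union_right.2
      ⟨(hcross _ (e j).2 _ (e i).2 hne.symm).symm, hEE _ (hσmem _ (e i).2) _ (hσmem _ (e j).2)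
        fun h => hne (hσinj _ (e i).2 _ (e j).2 h)⟩⟩

/-- Pairwise disjoint walks joining `s i` to `t i`, all of them inside `D`. -/
def Linkable {ι : Type*} (G : SimpleGraph V) (D : Set V) (s t : ι → V) : Prop :=
  ∃ A : ι → Set V, (∀ i, A i ⊆ D) ∧ (∀ i, G.JoinedIn (A i) (s i) (t i)) ∧
    Pairwise fun i j => Disjoint (A i) (A j)

theorem isLinked_of_linkable {k : ℕ} (hcard : ((2 * k : ℕ) : ℕ∞) ≤ ENat.card V)
    (h : ∀ s t : Fin k → V, Function.Injective (Sum.elim s t) → G.Linkable Set.univ s t) :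
    G.IsLinked k := by
  refine ⟨hcard, fun s t hst => ?_⟩
  obtain ⟨A, -, hA, hdisj⟩ := h s t hst
  choose p hp using fun i => (hA i).exists_path
  refine ⟨p, fun i j hij z hz hz' => Set.disjoint_left.1 (hdisj hij) (hp i z hz) (hp j z hz')⟩

end SimpleGraph

/-! ### The cube graph: facets, projections and connectivity. -/

open SimpleGraph

/-- The graph of the `m`-cube. -/
def cubeGraph (m : ℕ) : SimpleGraph (Fin m → Bool) where
  Adj x y := ∃ i, y = Function.update x i (!x i)
  symm := ⟨by
    rintro x y ⟨i, rfl⟩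
    exact ⟨i, by simp⟩⟩
  loopless := ⟨by
    rintro x ⟨i, h⟩
    simpa using congrFun h i⟩

namespace Cube

variable {m : ℕ} {i : Fin (m + 1)} {b : Bool} {x y : Fin (m + 1) → Bool} {z z' : Fin m → Bool}

/-- The point of the facet `x i = b` of the cube with the other coordinates given by `z`. -/
def ins (i : Fin (m + 1)) (b : Bool) (z : Fin m → Bool) : Fin (m + 1) → Bool :=
  Fin.insertNth (α := fun _ => Bool) i b z

/-- Forget the coordinate `i`. -/
def prj (i : Fin (m + 1)) (x : Fin (m + 1) → Bool) : Fin m → Bool := fun j => x (i.succAbove j)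

@[simp] theorem ins_self : ins i b z i = b := by simp [ins]

@[simp] theorem prj_ins : prj i (ins i b z) = z := by
  ext j
  simp [prj, ins]

theorem ext_prj (h : x i = y i) (h' : prj i x = prj i y) : x = y := by
  ext j
  rcases Fin.eq_self_or_eq_succAbove i j with rfl | ⟨k, rfl⟩
  exacts [by rw [h], by simpa [prj] using congrFun h' k]

theorem ins_prj (h : x i = b) : ins i b (prj i x) = x :=
  ext_prj (i := i) (by simp [h]) (by simp)

theorem ins_eq_iff : ins i b z = x ↔ x i = b ∧ prj i x = z :=
  ⟨by rintro rfl; simp, fun h => by rw [← h.2, ins_prj h.1]⟩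

theorem ins_injective : Function.Injective (ins i b) := fun z z' h => by
  simpa using congrArg (prj i) h

theorem eq_not_of_ne {a b : Bool} (h : a ≠ b) : a = !b := by cases a <;> cases b <;> simp_all

theorem adj_ins (h : (cubeGraph m).Adj z z') : (cubeGraph (m + 1)).Adj (ins i b z) (ins i b z') := by
  obtain ⟨j, rfl⟩ := h
  refine ⟨i.succAbove j, ?_⟩
  simp [ins]

theorem adj_cross {b' : Bool} (h : b ≠ b') :
    (cubeGraph (m + 1)).Adj (ins i b z) (ins i b' z) := by
  refine ⟨i, ext_prj (i := i) (by simp [eq_not_of_ne h.symm]) ?_⟩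
  ext j
  simp [prj, ins, Fin.succAbove_ne]

/-- The only neighbour of `x` across the direction `i`. -/
theorem eq_update_of_prj_eq (h : x ≠ y) (h' : prj i x = prj i y) :
    y = Function.update x i (!x i) := by
  refine ext_prj (i := i) ?_ ?_
  · simpa using eq_not_of_ne fun h2 => h (ext_prj h2.symm h')
  · ext j
    simpa [prj, Fin.succAbove_ne] using (congrFun h' j).symm

theorem joinedIn_climb {D : Set (Fin (m + 1) → Bool)} (b : Bool) (hx : x ∈ D)
    (h : ins i b (prj i x) ∈ D) : (cubeGraph (m + 1)).JoinedIn D x (ins i b (prj i x)) := by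
  by_cases hb : x i = b
  · rw [ins_prj hb]
    exact .refl hx
  · refine .of_adj ?_ hx h
    nth_rewrite 1 [← ins_prj (i := i) (x := x) rfl]
    exact adj_cross hb

theorem joinedIn_ins {D : Set (Fin m → Bool)} {D' : Set (Fin (m + 1) → Bool)}
    (h : (cubeGraph m).JoinedIn D z z') (hD : ∀ u ∈ D, ins i b u ∈ D') :
    (cubeGraph (m + 1)).JoinedIn D' (ins i b z) (ins i b z') :=
  h.map (fun _ _ => adj_ins) hD

/-! ### Directions without edges -/

/-- Forgetting a coordinate in which two points of `X` are adjacent merges them, so each of the `m`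
projections loses at least one point, and a point is left at the end. -/
theorem card_of_forall_update (X : Finset (Fin m → Bool)) (hX : X.Nonempty)
    (h : ∀ i, ∃ x ∈ X, Function.update x i (!x i) ∈ X) : m + 1 ≤ X.card := by
  classical
  induction m with
  | zero => simpa using hX.card_pos
  | succ m ih =>
    have h1 := ih (X.image (prj 0)) (hX.image _) fun i => by
      obtain ⟨x, hx, hx'⟩ := h i.succ
      refine ⟨prj 0 x, Finset.mem_image_of_mem _ hx, Finset.mem_image.2 ⟨_, hx', ?_⟩⟩
      ext j
      by_cases hj : j = i
      · subst hj
        simp [prj]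
      · simp [prj, hj]
    have h2 : (X.image (prj 0)).card < X.card := by
      refine lt_of_le_of_ne Finset.card_image_le fun he => ?_
      obtain ⟨x, hx, hx'⟩ := h 0
      have := Finset.card_image_iff.1 he hx hx' (by ext j; simp [prj])
      simpa using congrFun this 0
    omega

/-- Bondy's theorem. The bound is what lets the terminals be pushed into a facet without collisions.
-/
theorem exists_injOn_prj (X : Finset (Fin (m + 1) → Bool)) (hX : X.card ≤ m + 1) :
    ∃ i, Set.InjOn (prj i) (X : Set (Fin (m + 1) → Bool)) := by
  rcases X.eq_empty_or_nonempty with rfl | hne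
  · exact ⟨0, by simp⟩
  by_contra! h
  have := card_of_forall_update X hne fun i => by
    have h1 := h i
    unfold Set.InjOn at h1
    push Not at h1
    obtain ⟨x, hx, y, hy, hxy, hne⟩ := h1
    exact ⟨x, hx, eq_update_of_prj_eq hne hxy ▸ hy⟩
  omega

/-! ### Connectivity -/

/-- The part of `Y` in the facet `x i = b`. -/
def side (Y : Finset (Fin (m + 1) → Bool)) (i : Fin (m + 1)) (b : Bool) : Finset (Fin m → Bool) :=
  Finset.univ.filter fun z => ins i b z ∈ Y

theorem mem_side {Y : Finset (Fin (m + 1) → Bool)} : z ∈ side Y i b ↔ ins i b z ∈ Y := by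
  simp [side]

theorem card_side_add_card_side (Y : Finset (Fin (m + 1) → Bool)) (i : Fin (m + 1)) (b : Bool) :
    (side Y i b).card + (side Y i (!b)).card = Y.card := by
  have h : ∀ b, (side Y i b).card = (Y.filter fun x => x i = b).card := fun b => by
    rw [← Finset.card_image_of_injective _ (ins_injective (i := i) (b := b))]
    congr 1
    ext x
    simp only [Finset.mem_image, mem_side, Finset.mem_filter]
    exact ⟨by rintro ⟨z, hz, rfl⟩; exact ⟨hz, by simp⟩,
      fun hx => ⟨prj i x, by rw [ins_prj hx.2]; exact hx.1, ins_prj hx.2⟩⟩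
  rw [h, h, ← Finset.card_filter_add_card_filter_not (s := Y) (fun x => x i = b)]
  congr 2
  ext x
  cases h : x i <;> cases b <;> simp [h]

theorem joinedIn_of_side {Y : Finset (Fin (m + 1) → Bool)} (hx : x i = b) (hy : y i = b)
    (h : (cubeGraph m).JoinedIn (side Y i b : Set (Fin m → Bool))ᶜ (prj i x) (prj i y)) :
    (cubeGraph (m + 1)).JoinedIn (Y : Set (Fin (m + 1) → Bool))ᶜ x y := by
  have := joinedIn_ins (i := i) (b := b) (D' := (Y : Set (Fin (m + 1) → Bool))ᶜ) h
    fun u hu h => hu (by simpa [mem_side] using h)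
  rwa [ins_prj hx, ins_prj hy] at this

theorem exists_ins_notMem (Y : Finset (Fin (m + 1) → Bool)) (hY : Y.card < 2 ^ m)
    (i : Fin (m + 1)) : ∃ z, ∀ b, ins i b z ∉ Y := by
  by_contra! h
  have h1 := Finset.card_le_card (s := Finset.univ) (t := side Y i true ∪ side Y i false)
    fun z _ => by
      obtain ⟨b, hb⟩ := h z
      cases b <;> simp [mem_side, hb]
  have h2 := Finset.card_union_le (side Y i true) (side Y i false)
  have h3 := card_side_add_card_side Y i true
  simp only [Finset.card_univ, Fintype.card_fun, Fintype.card_bool, Fintype.card_fin] at h1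
  simp only [Bool.not_true] at h3
  omega

/-- The `m`-cube stays connected when fewer than `m` vertices are deleted. -/
theorem joinedIn_compl {m : ℕ} (Y : Finset (Fin m → Bool)) (hY : Y.card ≤ m - 1)
    {s t : Fin m → Bool} (hs : s ∉ Y) (ht : t ∉ Y) :
    (cubeGraph m).JoinedIn (Y : Set (Fin m → Bool))ᶜ s t := by
  induction m with
  | zero =>
    rw [Subsingleton.elim t s]
    exact .refl hs
  | succ m ih =>
    by_cases hst : s = t
    · rw [hst]
      exact .refl ht
    obtain ⟨i, hi⟩ := Function.ne_iff.1 hst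
    have along : ∀ x y, x ∉ Y → y ∉ Y → x i = y i → (side Y i (y i)).card ≤ m - 1 →
        (cubeGraph (m + 1)).JoinedIn (Y : Set (Fin (m + 1) → Bool))ᶜ x y := by
      intro x y hx hy hxy hcard
      exact joinedIn_of_side hxy rfl (ih (side Y i (y i)) hcard
        (by rwa [mem_side, ins_prj hxy]) (by rwa [mem_side, ins_prj rfl]))
    have hub : ∀ x y, x ∉ Y → y ∉ Y → ins i (y i) (prj i x) ∉ Y →
        (side Y i (y i)).card ≤ m - 1 →
        (cubeGraph (m + 1)).JoinedIn (Y : Set (Fin (m + 1) → Bool))ᶜ x y :=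
      fun x y hx hy hxy hcard => (joinedIn_climb _ hx hxy).trans
        (along _ _ hxy hy (by simp) hcard)
    have hsum := card_side_add_card_side Y i (s i)
    rw [← eq_not_of_ne hi.symm] at hsum
    -- If one side has no deleted vertex, the other may have too many for the induction hypothesis,
    -- so the walk crosses at once to the free side. Otherwise each side has at most `m - 1`, and a
    -- free edge across exists by counting.
    by_cases h0 : (side Y i (t i)).card = 0
    · refine hub s t hs ht (fun h => ?_) (by omega)
      rw [Finset.card_eq_zero] at h0
      simpa [h0] using mem_side.2 h
    by_cases h1 : (side Y i (s i)).card = 0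
    · refine (hub t s ht hs (fun h => ?_) (by omega)).symm
      rw [Finset.card_eq_zero] at h1
      simpa [h1] using mem_side.2 h
    have hpow : m < 2 ^ m := Nat.lt_two_pow_self
    obtain ⟨z, hz⟩ := exists_ins_notMem Y (by omega) i
    exact (along s _ hs (hz (s i)) (by simp) (by simp only [ins_self]; omega)).trans
      (.trans (.of_adj (adj_cross hi) (hz _) (hz _)) (along _ t (hz _) ht (by simp) (by omega)))

/-- Two vertices of the `m`-cube stay connected when `m` vertices are deleted, provided both keep
a neighbour. -/
theorem joinedIn_compl' (hm : 2 ≤ m) (Y : Finset (Fin (m + 1) → Bool)) (hY : Y.card ≤ m + 1)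
    {s t : Fin (m + 1) → Bool} (hs : s ∉ Y) (ht : t ∉ Y)
    (hs' : ∃ n, (cubeGraph (m + 1)).Adj s n ∧ n ∉ Y)
    (ht' : ∃ n, (cubeGraph (m + 1)).Adj t n ∧ n ∉ Y) :
    (cubeGraph (m + 1)).JoinedIn (Y : Set (Fin (m + 1) → Bool))ᶜ s t := by
  by_cases hst : s = t
  · rw [hst]
    exact .refl ht
  obtain ⟨i, hi⟩ := Function.ne_iff.1 hst
  have along : ∀ x y, x ∉ Y → y ∉ Y → x i = y i → (side Y i (y i)).card ≤ m - 1 →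
      (cubeGraph (m + 1)).JoinedIn (Y : Set (Fin (m + 1) → Bool))ᶜ x y := by
    intro x y hx hy hxy hcard
    exact joinedIn_of_side hxy rfl (joinedIn_compl (side Y i (y i)) hcard
      (by rwa [mem_side, ins_prj hxy]) (by rwa [mem_side, ins_prj rfl]))
  have hub : ∀ x y, x ∉ Y → y ∉ Y → x i ≠ y i → (∃ n, (cubeGraph (m + 1)).Adj x n ∧ n ∉ Y) →
      (side Y i (y i)).card ≤ 1 →
      (cubeGraph (m + 1)).JoinedIn (Y : Set (Fin (m + 1) → Bool))ᶜ x y := by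
    rintro x y hx hy hxy ⟨n, hxn, hn⟩ hcard
    have go : ∀ x, x ∉ Y → ins i (y i) (prj i x) ∉ Y →
        (cubeGraph (m + 1)).JoinedIn (Y : Set (Fin (m + 1) → Bool))ᶜ x y :=
      fun x hx hxy => (joinedIn_climb _ hx hxy).trans (along _ _ hxy hy (by simp) (by omega))
    -- If the vertex opposite `x` is deleted, it is the only deleted one on that side, so the
    -- crossing from the neighbour `n` is free.
    by_cases hx2 : ins i (y i) (prj i x) ∈ Y
    · refine (go n hn fun hn2 => ?_).head hxn hx
      have h1 := Finset.card_le_one.1 hcard _ (mem_side.2 hx2) _ (mem_side.2 hn2)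
      have h2 : n i = x i := by
        by_contra h3
        rw [h1, ins_prj ((eq_not_of_ne h3).trans (eq_not_of_ne hxy.symm).symm)] at hx2
        exact hn hx2
      exact hxn.ne (ext_prj h2.symm h1)
    · exact go x hx hx2
  have hsum := card_side_add_card_side Y i (s i)
  rw [← eq_not_of_ne hi.symm] at hsum
  by_cases h0 : (side Y i (t i)).card ≤ 1
  · exact hub s t hs ht hi hs' h0
  by_cases h1 : (side Y i (s i)).card ≤ 1
  · exact (hub t s ht hs hi.symm ht' h1).symm
  -- Both sides now contain at least two deleted vertices, hence at most `m - 1` each, and plain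
  -- connectivity applies on either side.
  have hpow : m + 1 < 2 ^ m := by
    obtain ⟨k, rfl⟩ := Nat.exists_eq_add_of_le hm
    have : k < 2 ^ k := Nat.lt_two_pow_self
    rw [pow_add]
    omega
  obtain ⟨z, hz⟩ := exists_ins_notMem Y (by omega) i
  exact (along s _ hs (hz (s i)) (by simp) (by simp only [ins_self]; omega)).trans
    (.trans (.of_adj (adj_cross hi) (hz _) (hz _)) (along _ t (hz _) ht (by simp) (by omega)))

end Cube

/-! ### Linking two pairs in the 4-cube outside a fifth vertex. -/

namespace Cube

variable {m : ℕ}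

/-- The `m`-cube links all families of at most `(m + 1) / 2` pairs. -/
def Linked (m : ℕ) : Prop :=
  ∀ (ι : Type) [Fintype ι] (s t : ι → Fin m → Bool), Function.Injective (Sum.elim s t) →
    2 * Fintype.card ι ≤ m + 1 → (cubeGraph m).Linkable Set.univ s t

/-- The `m`-cube links all families of at most `m / 2` pairs outside any further vertex. -/
def StronglyLinked (m : ℕ) : Prop :=
  ∀ (ι : Type) [Fintype ι] (s t : ι → Fin m → Bool) (w : Fin m → Bool),
    Function.Injective (Sum.elim s t) → 2 * Fintype.card ι ≤ m → (∀ j, s j ≠ w ∧ t j ≠ w) →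
    (cubeGraph m).Linkable {w}ᶜ s t

/-- Link two pairs by dividing the cube in direction `i`: the first pair is joined on the side of
its first vertex, the second pair on the other side. -/
theorem twoLinkable_of_split {i : Fin (m + 1)} {b : Bool} {w s₁ t₁ s₂ t₂ : Fin (m + 1) → Bool}
    (hm : 3 ≤ m) (hs : s₁ i = b) (hw1 : s₁ ≠ w) (hw2 : t₁ ≠ w) (hw3 : s₂ ≠ w) (hw4 : t₂ ≠ w)
    (h12 : s₁ ≠ s₂) (h12' : s₁ ≠ t₂) (h21 : t₁ ≠ s₂) (h21' : t₁ ≠ t₂)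
    (hp1 : prj i t₁ ≠ prj i w) (hp2 : prj i s₂ ≠ prj i w) (hp3 : prj i t₂ ≠ prj i w)
    (hp4 : prj i t₁ ≠ prj i s₂) (hp5 : prj i t₁ ≠ prj i t₂)
    (hside : ¬ (s₂ i = b ∧ t₂ i = b ∧ w i = b)) :
    ∃ A B : Set (Fin (m + 1) → Bool), w ∉ A ∧ w ∉ B ∧ (cubeGraph (m + 1)).JoinedIn A s₁ t₁ ∧
      (cubeGraph (m + 1)).JoinedIn B s₂ t₂ ∧ Disjoint A B := by
  classical
  -- By `hside` at most two of the three obstacles lie on the side of `s₁`, and `m ≥ 3` makes two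
  -- deletions harmless there.
  have hX : (({s₂, t₂, w} : Finset (Fin (m + 1) → Bool)).filter fun x => x i = b).card ≤ 2 := by
    have h3 : ({s₂, t₂, w} : Finset (Fin (m + 1) → Bool)).card ≤ 3 := Finset.card_le_three
    refine Nat.lt_succ_iff.1 (lt_of_lt_of_le (Finset.card_lt_card
      (Finset.filter_ssubset.2 ?_)) h3)
    by_contra! h
    exact hside ⟨h _ (by simp), h _ (by simp), h _ (by simp)⟩
  have hY := (Finset.card_image_le (f := prj i)).trans hX
  set Y := (({s₂, t₂, w} : Finset (Fin (m + 1) → Bool)).filter fun x => x i = b).image (prj i)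
    with hYdef
  have hYmem : ∀ z, z ∈ Y ↔ ins i b z = s₂ ∨ ins i b z = t₂ ∨ ins i b z = w := by
    intro z
    simp only [hYdef, Finset.mem_image, Finset.mem_filter, Finset.mem_insert,
      Finset.mem_singleton]
    constructor
    · rintro ⟨x, ⟨hx, hxb⟩, rfl⟩
      rwa [ins_prj hxb]
    · exact fun h => ⟨_, ⟨h, ins_self⟩, prj_ins⟩
  refine ⟨{x | x i = b ∧ x ≠ s₂ ∧ x ≠ t₂ ∧ x ≠ w ∨ x = t₁},
    {x | x i ≠ b ∧ x ≠ w ∧ prj i x ≠ prj i t₁ ∨ x = s₂ ∨ x = t₂}, ?_, ?_, ?_, ?_, ?_⟩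
  · simp [hw2.symm]
  · simp [hw3.symm, hw4.symm]
  · have h1 := joinedIn_ins (i := i) (b := b)
      (D' := {x | x i = b ∧ x ≠ s₂ ∧ x ≠ t₂ ∧ x ≠ w ∨ x = t₁})
      (joinedIn_compl Y (by omega) (s := prj i s₁) (t := prj i t₁)
        (by rw [hYmem, ins_prj hs]; simp [*])
        (by
          simp only [hYmem, ins_eq_iff, not_or]
          exact ⟨fun h => hp4 h.2.symm, fun h => hp5 h.2.symm, fun h => hp1 h.2.symm⟩))
      (fun u hu => by
        simp only [Set.mem_compl_iff, Finset.mem_coe, hYmem, not_or] at hu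
        exact .inl ⟨ins_self, hu⟩)
    rw [ins_prj hs] at h1
    exact h1.trans (joinedIn_climb b (.inr rfl) h1.right_mem).symm
  · have hY2 : ({prj i w, prj i t₁} : Finset (Fin m → Bool)).card ≤ m - 1 :=
      Finset.card_le_two.trans (by omega)
    have h1 := joinedIn_ins (i := i) (b := !b)
      (D' := {x | x i ≠ b ∧ x ≠ w ∧ prj i x ≠ prj i t₁ ∨ x = s₂ ∨ x = t₂})
      (joinedIn_compl _ hY2 (s := prj i s₂) (t := prj i t₂)
        (by simp [hp2, hp4.symm]) (by simp [hp3, hp5.symm]))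
      (fun u hu => by
        simp only [Finset.coe_insert, Finset.coe_singleton, Set.mem_compl_iff,
          Set.mem_insert_iff, Set.mem_singleton_iff, not_or] at hu
        refine .inl ⟨by simp, fun h => hu.1 (by rw [← h, prj_ins]), by simpa using hu.2⟩)
    exact (joinedIn_climb _ (.inr (.inl rfl)) h1.left_mem).trans
      (h1.trans (joinedIn_climb _ (.inr (.inr rfl)) h1.right_mem).symm)
  · rw [Set.disjoint_left]
    rintro x (⟨hx, h1, h2, -⟩ | rfl) (⟨h3, -, h4⟩ | rfl | rfl)
    exacts [h3 hx, h1 rfl, h2 rfl, h4 rfl, h21 rfl, h21' rfl]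

/-- Link two pairs on the same side of the cube in direction `i`: the first pair is joined on this
side, the second pair on the other one. -/
theorem twoLinkable_of_side {i : Fin (m + 1)} {b : Bool} {w s₁ t₁ s₂ t₂ : Fin (m + 1) → Bool}
    (hs1 : s₁ i = b) (ht1 : t₁ i = b) (hs2 : s₂ i = b) (ht2 : t₂ i = b) (hw : w i = b)
    (hw3 : s₂ ≠ w) (hw4 : t₂ ≠ w)
    (h : (cubeGraph m).JoinedIn {prj i s₂, prj i t₂, prj i w}ᶜ (prj i s₁) (prj i t₁)) :
    ∃ A B : Set (Fin (m + 1) → Bool), w ∉ A ∧ w ∉ B ∧ (cubeGraph (m + 1)).JoinedIn A s₁ t₁ ∧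
      (cubeGraph (m + 1)).JoinedIn B s₂ t₂ ∧ Disjoint A B := by
  refine ⟨{x | x i = b ∧ x ≠ s₂ ∧ x ≠ t₂ ∧ x ≠ w}, {x | x i ≠ b ∨ x = s₂ ∨ x = t₂}, ?_, ?_, ?_,
    ?_, ?_⟩
  · simp
  · simp [hw, hw3.symm, hw4.symm]
  · have h1 := joinedIn_ins (i := i) (b := b) h
      (D' := {x | x i = b ∧ x ≠ s₂ ∧ x ≠ t₂ ∧ x ≠ w}) fun u hu => by
        simp only [Set.mem_compl_iff, Set.mem_insert_iff, Set.mem_singleton_iff, not_or] at hu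
        refine ⟨ins_self, fun h => hu.1 ?_, fun h => hu.2.1 ?_, fun h => hu.2.2 ?_⟩ <;>
          rw [← h, prj_ins]
    rwa [ins_prj hs1, ins_prj ht1] at h1
  · have h1 := joinedIn_ins (i := i) (b := !b) (D' := {x | x i ≠ b ∨ x = s₂ ∨ x = t₂})
      (joinedIn_compl (∅ : Finset (Fin m → Bool)) (by simp) (s := prj i s₂) (t := prj i t₂)
        (by simp) (by simp)) fun u _ => .inl (by simp)
    exact (joinedIn_climb _ (.inr (.inl rfl)) h1.left_mem).trans
      (h1.trans (joinedIn_climb _ (.inr (.inr rfl)) h1.right_mem).symm)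
  · rw [Set.disjoint_left]
    rintro x ⟨hx, h1, h2, -⟩ (h3 | rfl | rfl)
    exacts [h3 hx, h1 rfl, h2 rfl]

/-- The parity of the number of coordinates equal to `true`. -/
def parity (x : Fin m → Bool) : ZMod 2 := ∑ i, if x i then 1 else 0

theorem parity_eq (i : Fin (m + 1)) (x : Fin (m + 1) → Bool) :
    parity x = (if x i then 1 else 0) + parity (prj i x) :=
  Fin.sum_univ_succAbove _ i

theorem parity_adj {x y : Fin m → Bool} (h : (cubeGraph m).Adj x y) : parity y = parity x + 1 := by
  obtain ⟨i, rfl⟩ := h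
  cases m with
  | zero => exact i.elim0
  | succ m =>
    have : prj i (Function.update x i (!x i)) = prj i x := by
      ext j
      simp [prj, Fin.succAbove_ne]
    rw [parity_eq i, parity_eq i x, this]
    cases x i
    · simp [add_comm]
    · simp [add_right_comm 1 (parity (prj i x)) 1, show (1 + 1 : ZMod 2) = 0 from rfl]

theorem parity_ne_of_prj_eq {i : Fin (m + 1)} {x y : Fin (m + 1) → Bool} (h : x ≠ y)
    (h' : prj i x = prj i y) : parity x ≠ parity y := by
  rw [parity_adj (x := x) (y := y) ⟨i, eq_update_of_prj_eq h h'⟩]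
  simp

/-- A set of at most `m` vertices of the `m`-cube containing all neighbours of `s` contains nothing
else. -/
theorem adj_of_mem_of_forall_adj {Y : Finset (Fin m → Bool)} (hY : Y.card ≤ m) {s : Fin m → Bool}
    (h : ∀ n, (cubeGraph m).Adj s n → n ∈ Y) {y : Fin m → Bool} (hy : y ∈ Y) :
    (cubeGraph m).Adj s y := by
  classical
  have hinj : Function.Injective fun i => Function.update s i (!s i) := fun i j hij => by
    by_contra hne
    have := congrFun hij i
    simp [hne] at this
  have hsub : Finset.univ.image (fun i => Function.update s i (!s i)) ⊆ Y := by
    intro n hn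
    obtain ⟨i, -, rfl⟩ := Finset.mem_image.1 hn
    exact h _ ⟨i, rfl⟩
  rw [← Finset.eq_of_subset_of_card_le hsub
    (by rw [Finset.card_image_of_injective _ hinj]; simpa using hY)] at hy
  obtain ⟨i, -, rfl⟩ := Finset.mem_image.1 hy
  exact ⟨i, rfl⟩

/-- Splitting along a direction that keeps `w, t₁, s₂, t₂` apart works unless all five vertices lie
in one 3-cube facet. There, one pair is joined inside the facet and the other through the opposite
facet. This fails only if an end of the first pair has the other three vertices as its neighbours,
and by parity it cannot fail for both choices of the inner pair. -/
theorem twoLinkable {w s₁ t₁ s₂ t₂ : Fin 4 → Bool} (hw1 : s₁ ≠ w) (hw2 : t₁ ≠ w) (hw3 : s₂ ≠ w)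
    (hw4 : t₂ ≠ w) (h12 : s₁ ≠ s₂) (h12' : s₁ ≠ t₂)
    (h21 : t₁ ≠ s₂) (h21' : t₁ ≠ t₂) :
    ∃ A B : Set (Fin 4 → Bool), w ∉ A ∧ w ∉ B ∧ (cubeGraph 4).JoinedIn A s₁ t₁ ∧
      (cubeGraph 4).JoinedIn B s₂ t₂ ∧ Disjoint A B := by
  classical
  obtain ⟨i, hi⟩ := exists_injOn_prj ({w, t₁, s₂, t₂} : Finset (Fin 4 → Bool)) Finset.card_le_four
  have hinj : ∀ x ∈ ({w, t₁, s₂, t₂} : Finset (Fin 4 → Bool)),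
      ∀ y ∈ ({w, t₁, s₂, t₂} : Finset (Fin 4 → Bool)), x ≠ y → prj i x ≠ prj i y :=
    fun x hx y hy hne h => hne (hi hx hy h)
  by_cases hside : s₂ i = s₁ i ∧ t₂ i = s₁ i ∧ w i = s₁ i
  swap
  · exact twoLinkable_of_split le_rfl rfl hw1 hw2 hw3 hw4 h12 h12' h21 h21'
      (hinj _ (by simp) _ (by simp) hw2) (hinj _ (by simp) _ (by simp) hw3)
      (hinj _ (by simp) _ (by simp) hw4) (hinj _ (by simp) _ (by simp) h21)
      (hinj _ (by simp) _ (by simp) h21') hside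
  obtain ⟨hs2, ht2, hw⟩ := hside
  have hp : ∀ {x y : Fin 4 → Bool}, x i = s₁ i → y i = s₁ i → x ≠ y → prj i x ≠ prj i y :=
    fun hx hy hne h => hne (ext_prj (hx.trans hy.symm) h)
  by_cases ht1 : t₁ i = s₁ i
  swap
  · obtain ⟨A, B, hA, hB, h1, h2, hd⟩ := twoLinkable_of_split (i := i) le_rfl rfl hw2 hw1 hw3 hw4
      h21 h21' h12 h12' (hp rfl hw hw1) (hp hs2 hw hw3) (hp ht2 hw hw4) (hp rfl hs2 h12)
      (hp rfl ht2 h12') fun h => ht1 (h.1.symm.trans hs2)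
    exact ⟨A, B, hA, hB, h1.symm, h2, hd⟩
  have key : ∀ s t p q : Fin 4 → Bool, s i = s₁ i → t i = s₁ i → p i = s₁ i → q i = s₁ i →
      s ≠ p → s ≠ q → s ≠ w → t ≠ p → t ≠ q → t ≠ w → p ≠ w → q ≠ w →
      (∃ A B : Set (Fin 4 → Bool), w ∉ A ∧ w ∉ B ∧ (cubeGraph 4).JoinedIn A s t ∧
        (cubeGraph 4).JoinedIn B p q ∧ Disjoint A B) ∨
      parity p = parity w ∧ parity q = parity w ∧
        (parity s = parity w + 1 ∨ parity t = parity w + 1) := by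
    intro s t p q hs ht hpi hq h1 h2 h3 h4 h5 h6 h7 h8
    set Y : Finset (Fin 3 → Bool) := {prj i p, prj i q, prj i w} with hY
    have hYc : Y.card ≤ 3 := Finset.card_le_three
    -- A vertex of the 3-cube with all neighbours in the set `Y` of at most three vertices has
    -- nothing else in `Y`, so all of `Y` has the opposite parity.
    have bad : ∀ s, s i = s₁ i → ¬ (∃ n, (cubeGraph 3).Adj (prj i s) n ∧ n ∉ Y) →
        parity p = parity w ∧ parity q = parity w ∧ parity s = parity w + 1 := by
      intro s hs h
      push Not at h
      have hpar : ∀ y, y i = s₁ i → prj i y ∈ Y → parity y = parity s + 1 := fun y hy hyY => by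
        have := parity_adj (adj_of_mem_of_forall_adj hYc h hyY)
        rw [parity_eq i y, this, parity_eq i s, hy, hs, add_assoc]
      rw [hpar p hpi (by simp [hY]), hpar q hq (by simp [hY]), hpar w hw (by simp [hY]),
        add_assoc]
      simp [show (1 + 1 : ZMod 2) = 0 from rfl]
    by_cases hs' : ∃ n, (cubeGraph 3).Adj (prj i s) n ∧ n ∉ Y
    swap
    · exact .inr (by have := bad s hs hs'; tauto)
    by_cases ht' : ∃ n, (cubeGraph 3).Adj (prj i t) n ∧ n ∉ Y
    swap
    · exact .inr (by have := bad t ht ht'; tauto)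
    refine .inl (twoLinkable_of_side hs ht hpi hq hw h7 h8 ?_)
    have := joinedIn_compl' le_rfl Y hYc (s := prj i s) (t := prj i t)
      (by simp [hY, hp hs hpi h1, hp hs hq h2, hp hs hw h3])
      (by simp [hY, hp ht hpi h4, hp ht hq h5, hp ht hw h6]) hs' ht'
    simpa [hY] using this
  rcases key s₁ t₁ s₂ t₂ rfl ht1 hs2 ht2 h12 h12' hw1 h21 h21' hw2 hw3 hw4 with h | ⟨h1, h2, h3⟩
  · exact h
  rcases key s₂ t₂ s₁ t₁ hs2 ht2 rfl ht1 h12.symm h21.symm hw3 h12'.symm h21'.symm hw4 hw1 hw2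
    with ⟨A, B, hA, hB, h1, h2, hd⟩ | ⟨h4, h5, h6⟩
  · exact ⟨B, A, hB, hA, h2, h1, hd.symm⟩
  · rw [h4, h5] at h3
    simp at h3

end Cube

/-! ### Linking in all cubes of dimension at least 4. -/

namespace Cube

variable {m : ℕ}

theorem stronglyLinked_four : StronglyLinked 4 := by
  classical
  intro ι _ s t w hst hcard hw
  have hne : ∀ p q : ι ⊕ ι, p ≠ q → Sum.elim s t p ≠ Sum.elim s t q := fun p q h => hst.ne h
  by_cases h : ∃ a c : ι, a ≠ c
  · obtain ⟨a, c, hac⟩ := h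
    obtain ⟨A, B, hA, hB, h1, h2, hd⟩ := twoLinkable (hw a).1 (hw a).2 (hw c).1 (hw c).2
      (hne (.inl a) (.inl c) (by simpa)) (hne (.inl a) (.inr c) (by simp))
      (hne (.inr a) (.inl c) (by simp)) (hne (.inr a) (.inr c) (by simpa))
    have hall : ∀ j, j = a ∨ j = c := by
      by_contra! h
      obtain ⟨j, hja, hjc⟩ := h
      have := Finset.card_le_univ ({j, a, c} : Finset ι)
      rw [Finset.card_eq_three.2 ⟨j, a, c, hja, hjc, hac, rfl⟩] at this
      omega
    refine ⟨fun j => if j = a then A else B, fun j => ?_, fun j => ?_, fun j l hjl => ?_⟩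
    · dsimp only
      split_ifs
      · exact fun x hx h => hA (h ▸ hx)
      · exact fun x hx h => hB (h ▸ hx)
    · rcases hall j with rfl | rfl
      · simpa using h1
      · simpa [hac.symm] using h2
    · rcases hall j with rfl | rfl <;> rcases hall l with rfl | rfl
      · exact absurd rfl hjl
      · simpa [hac.symm] using hd
      · simpa [hac.symm] using hd.symm
      · exact absurd rfl hjl
  · push Not at h
    refine ⟨fun _ => {w}ᶜ, fun _ => le_rfl, fun j => ?_, fun j l hjl => absurd (h j l) hjl⟩
    simpa using joinedIn_compl (m := 4) {w} (by simp) (s := s j) (t := t j) (by simp [hw])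
      (by simp [hw])

/-- For even `m` the bounds `m + 1` and `m` allow the same number of pairs, and some non-terminal
vertex is available as the forbidden one. -/
theorem linked_of_stronglyLinked (h : StronglyLinked m) (hm : Even m) : Linked m := by
  classical
  intro ι _ s t hst hcard
  have hcard' : 2 * Fintype.card ι ≤ m := by
    obtain ⟨k, rfl⟩ := hm
    omega
  obtain ⟨w, hw⟩ : ∃ w, w ∉ Finset.univ.image (Sum.elim s t) := by
    by_contra! h
    have h1 := Finset.card_le_card (s := Finset.univ) fun z _ => h z
    have h2 := h1.trans Finset.card_image_le
    simp only [Finset.card_univ, Fintype.card_fun, Fintype.card_bool, Fintype.card_fin,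
      Fintype.card_sum] at h2
    have : m < 2 ^ m := Nat.lt_two_pow_self
    omega
  obtain ⟨A, -, hA⟩ := h ι s t w hst hcard' fun j =>
    ⟨fun h => hw (Finset.mem_image.2 ⟨.inl j, by simp, h⟩),
      fun h => hw (Finset.mem_image.2 ⟨.inr j, by simp, h⟩)⟩
  exact ⟨A, fun _ => Set.subset_univ _, hA⟩

/-- The union of a set in the facet `x i = b` with two points, all above `A`. -/
def lift (i : Fin (m + 1)) (b : Bool) (A : Set (Fin m → Bool)) (s t : Fin (m + 1) → Bool) :
    Set (Fin (m + 1) → Bool) :=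
  {x | prj i x ∈ A ∧ (x i = b ∨ x = s ∨ x = t)}

theorem joinedIn_lift {i : Fin (m + 1)} {b : Bool} {A : Set (Fin m → Bool)}
    {s t : Fin (m + 1) → Bool} (h : (cubeGraph m).JoinedIn A (prj i s) (prj i t)) :
    (cubeGraph (m + 1)).JoinedIn (lift i b A s t) s t := by
  have h1 := joinedIn_ins (i := i) (b := b) (D' := lift i b A s t) h
    fun u hu => ⟨by simpa using hu, .inl ins_self⟩
  have hs : s ∈ lift i b A s t := ⟨h.left_mem, .inr (.inl rfl)⟩
  have ht : t ∈ lift i b A s t := ⟨h.right_mem, .inr (.inr rfl)⟩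
  exact (joinedIn_climb b hs h1.left_mem).trans
    (h1.trans (joinedIn_climb b ht h1.right_mem).symm)

/-- The terminals are projected injectively and linked in the facet opposite to `w`. Off this facet
the walks contain only terminals, so they miss `w`. -/
theorem stronglyLinked_succ (h : Linked m) : StronglyLinked (m + 1) := by
  classical
  intro ι _ s t w hst hcard hw
  obtain ⟨i, hi⟩ := exists_injOn_prj (Finset.univ.image (Sum.elim s t)) (by
    refine Finset.card_image_le.trans ?_
    simp only [Finset.card_univ, Fintype.card_sum]
    omega)
  obtain ⟨A, -, hA, hd⟩ := h ι (prj i ∘ s) (prj i ∘ t) (by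
    rw [← Sum.comp_elim]
    exact fun p q hpq => hst (hi
      (Finset.mem_coe.2 (Finset.mem_image_of_mem _ (Finset.mem_univ p)))
      (Finset.mem_coe.2 (Finset.mem_image_of_mem _ (Finset.mem_univ q))) hpq)) hcard
  refine ⟨fun j => lift i (!(w i)) (A j) (s j) (t j), fun j x hx hxw => ?_,
    fun j => joinedIn_lift (hA j), fun j l hjl => Set.disjoint_left.2 fun x hx hx' =>
      Set.disjoint_left.1 (hd hjl) hx.1 hx'.1⟩
  rcases hx.2 with h | rfl | rfl
  · rw [hxw] at h
    simp at h
  · exact (hw j).1 hxw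
  · exact (hw j).2 hxw

/-- The pair `a` is joined in the facet of `s a`, and all other pairs in the opposite facet. There
the projection of `t a` is the forbidden vertex of `StronglyLinked`, which leaves `t a` free to
cross over. Since `s a` is already in its facet, its projection may collide with others. -/
theorem linkable_of_split (h : StronglyLinked m) {ι : Type} [Fintype ι]
    {s t : ι → Fin (m + 1) → Bool} (hcard : 2 * Fintype.card ι ≤ m + 2) (a : ι) (i : Fin (m + 1))
    (hinj : ∀ p q, p ≠ .inl a → q ≠ .inl a → prj i (Sum.elim s t p) = prj i (Sum.elim s t q) →
      p = q)
    (hjoin : (cubeGraph m).JoinedIn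
      {z | ∀ j ≠ a, ins i (s a i) z ≠ s j ∧ ins i (s a i) z ≠ t j} (prj i (s a)) (prj i (t a))) :
    (cubeGraph (m + 1)).Linkable Set.univ s t := by
  classical
  set b := s a i with hb
  obtain ⟨A, hAw, hA, hd⟩ := h {j // j ≠ a} (fun j => prj i (s j)) (fun j => prj i (t j))
    (prj i (t a)) (by
      rintro (j | j) (l | l) hjl
      · simpa [Subtype.ext_iff] using hinj (.inl j) (.inl l) (by simpa using j.2)
          (by simpa using l.2) hjl
      · simpa using hinj (.inl j) (.inr l) (by simpa using j.2) (by simp) hjl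
      · simpa using hinj (.inr j) (.inl l) (by simp) (by simpa using l.2) hjl
      · simpa [Subtype.ext_iff] using hinj (.inr j) (.inr l) (by simp) (by simp) hjl)
    (by
      have : Fintype.card {j // j ≠ a} = Fintype.card ι - 1 := by simp
      omega)
    (fun j => ⟨fun hj => by
        simpa using hinj (.inl j) (.inr a) (by simpa using j.2) (by simp) hj,
      fun hj => by simpa [j.2] using hinj (.inr j) (.inr a) (by simp) (by simp) hj⟩)
  have hA0 : (cubeGraph (m + 1)).JoinedIn
      {x | (x i = b ∧ ∀ j ≠ a, x ≠ s j ∧ x ≠ t j) ∨ x = t a} (s a) (t a) := by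
    have h1 := joinedIn_ins (i := i) (b := b)
      (D' := {x | (x i = b ∧ ∀ j ≠ a, x ≠ s j ∧ x ≠ t j) ∨ x = t a}) hjoin
      fun u hu => .inl ⟨ins_self, hu⟩
    rw [ins_prj hb.symm] at h1
    exact h1.trans (joinedIn_climb b (.inr rfl) h1.right_mem).symm
  have hd0 : ∀ j (hj : j ≠ a), Disjoint {x | (x i = b ∧ ∀ j ≠ a, x ≠ s j ∧ x ≠ t j) ∨ x = t a}
      (lift i (!b) (A ⟨j, hj⟩) (s j) (t j)) := by
    intro j hj
    rw [Set.disjoint_left]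
    rintro x (⟨hxb, hx⟩ | rfl) ⟨hxA, h2⟩
    · rcases h2 with h2 | h2 | h2
      · simp [hxb] at h2
      · exact (hx j hj).1 h2
      · exact (hx j hj).2 h2
    · exact hAw _ hxA rfl
  refine ⟨fun j => if hj : j = a then {x | (x i = b ∧ ∀ j ≠ a, x ≠ s j ∧ x ≠ t j) ∨ x = t a}
    else lift i (!b) (A ⟨j, hj⟩) (s j) (t j), fun _ => Set.subset_univ _, fun j => ?_,
    fun j l hjl => ?_⟩
  · by_cases hj : j = a
    · subst hj
      simpa using hA0
    · simpa [hj] using joinedIn_lift (hA ⟨j, hj⟩)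
  · by_cases hj : j = a <;> by_cases hl : l = a
    · exact absurd (hj.trans hl.symm) hjl
    · simpa only [hj, hl, dif_pos, dif_neg, not_false_eq_true] using hd0 l hl
    · simpa only [hj, hl, dif_pos, dif_neg, not_false_eq_true] using (hd0 j hj).symm
    · simp only [hj, hl, dif_neg, not_false_eq_true]
      exact Set.disjoint_left.2 fun x hx hx' => Set.disjoint_left.1
        (hd (i := ⟨j, hj⟩) (j := ⟨l, hl⟩) fun h => hjl (congrArg Subtype.val h)) hx.1 hx'.1

/-- At most `m` other terminals obstruct the pair `a` in its `m`-dimensional facet. The only danger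
is that all `m` lie there and surround an end, which forces them to have equal parity. If the other
terminals have equal parity for every `a` and there are at least three pairs, all terminals have
equal parity; then every direction projects them injectively, and one can be chosen that puts some
terminal in the opposite facet. -/
theorem linked_succ (hm : 4 ≤ m) (h : StronglyLinked m) : Linked (m + 1) := by
  classical
  intro ι _ s t hst hcard
  rcases isEmpty_or_nonempty ι with hι | ⟨⟨a₀⟩⟩
  · exact ⟨fun _ => ∅, fun _ => Set.subset_univ _, fun j => hι.elim j, fun j => hι.elim j⟩
  set O : ι → Finset (Fin (m + 1) → Bool) := fun a =>
    ((Finset.univ.erase a).image s) ∪ ((Finset.univ.erase a).image t) with hO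
  have hOcard : ∀ a, (O a).card ≤ 2 * (Fintype.card ι - 1) := fun a => by
    refine (Finset.card_union_le _ _).trans ?_
    have h1 := Finset.card_image_le (s := Finset.univ.erase a) (f := s)
    have h2 := Finset.card_image_le (s := Finset.univ.erase a) (f := t)
    rw [Finset.card_erase_of_mem (Finset.mem_univ a), Finset.card_univ] at h1 h2
    omega
  have hOmem : ∀ a x, x ∈ O a ↔ ∃ j ≠ a, s j = x ∨ t j = x := fun a x => by
    simp only [hO, Finset.mem_union, Finset.mem_image, Finset.mem_erase, Finset.mem_univ, and_true]
    grind
  have hne : ∀ p q : ι ⊕ ι, p ≠ q → Sum.elim s t p ≠ Sum.elim s t q := fun p q h => hst.ne h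
  have hsO : ∀ a, s a ∉ O a := fun a ha => by
    obtain ⟨j, hj, h | h⟩ := (hOmem a _).1 ha
    exacts [hne (.inl j) (.inl a) (by simpa) h, hne (.inr j) (.inl a) (by simp) h]
  have htO : ∀ a, t a ∉ O a := fun a ha => by
    obtain ⟨j, hj, h | h⟩ := (hOmem a _).1 ha
    exacts [hne (.inl j) (.inr a) (by simp) h, hne (.inr j) (.inr a) (by simpa) h]
  have bondy : ∀ a, ∃ i, ∀ p q : ι ⊕ ι, p ≠ .inl a → q ≠ .inl a →
      prj i (Sum.elim s t p) = prj i (Sum.elim s t q) → p = q := fun a => by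
    have hX : ((Finset.univ.erase (Sum.inl a)).image (Sum.elim s t)).card ≤ m + 1 := by
      refine Finset.card_image_le.trans ?_
      rw [Finset.card_erase_of_mem (Finset.mem_univ _), Finset.card_univ, Fintype.card_sum]
      omega
    obtain ⟨i, hi⟩ := exists_injOn_prj _ hX
    exact ⟨i, fun p q hp hq hpq => hst (hi
      (Finset.mem_coe.2 (Finset.mem_image_of_mem _ (by simpa using hp)))
      (Finset.mem_coe.2 (Finset.mem_image_of_mem _ (by simpa using hq))) hpq)⟩
  -- the general step: few of the other terminals lie in the facet of `s a`, or they are not all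
  -- of the same parity
  have step : ∀ a i, (∀ p q : ι ⊕ ι, p ≠ .inl a → q ≠ .inl a →
      prj i (Sum.elim s t p) = prj i (Sum.elim s t q) → p = q) →
      ((O a).card ≤ m - 1 ∨ (∃ x ∈ O a, x i ≠ s a i) ∨
        ∃ x ∈ O a, ∃ y ∈ O a, parity x ≠ parity y) →
      (cubeGraph (m + 1)).Linkable Set.univ s t := by
    intro a i hinj hcase
    refine linkable_of_split h hcard a i hinj ?_
    have hO' : ((O a).filter fun x => x i = s a i).card ≤ m :=
      (Finset.card_filter_le _ _).trans ((hOcard a).trans (by omega))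
    have hY := Finset.card_image_le (s := (O a).filter fun x => x i = s a i) (f := prj i)
    have hYmem : ∀ z, z ∈ ((O a).filter fun x => x i = s a i).image (prj i) ↔
        ins i (s a i) z ∈ O a := by
      intro z
      simp only [Finset.mem_image, Finset.mem_filter]
      exact ⟨by rintro ⟨x, ⟨hx, hxb⟩, rfl⟩; rwa [ins_prj hxb],
        fun h => ⟨_, ⟨h, ins_self⟩, prj_ins⟩⟩
    set Y := ((O a).filter fun x => x i = s a i).image (prj i) with hYdef
    have hsY : prj i (s a) ∉ Y := by
      rw [hYmem, ins_prj rfl]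
      exact hsO a
    have htY : prj i (t a) ∉ Y := by
      rw [hYmem]
      intro h
      obtain ⟨j, hj, h | h⟩ := (hOmem a _).1 h
      · simpa using hinj (.inl j) (.inr a) (by simpa) (by simp) (by simp [h])
      · simpa [hj] using hinj (.inr j) (.inr a) (by simp) (by simp) (by simp [h])
    have hsub : (Y : Set (Fin m → Bool))ᶜ ⊆
        {z | ∀ j ≠ a, ins i (s a i) z ≠ s j ∧ ins i (s a i) z ≠ t j} := fun z hz j hj =>
      ⟨fun h => hz ((hYmem z).2 ((hOmem a _).2 ⟨j, hj, .inl h.symm⟩)),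
        fun h => hz ((hYmem z).2 ((hOmem a _).2 ⟨j, hj, .inr h.symm⟩))⟩
    refine JoinedIn.mono_set hsub ?_
    by_cases hsmall : Y.card ≤ m - 1
    · exact joinedIn_compl Y hsmall hsY htY
    have hall : ∀ x ∈ O a, x i = s a i := by
      by_contra! hx
      have h1 := Finset.card_lt_card (Finset.filter_ssubset.2 hx)
      have := hOcard a
      omega
    obtain ⟨x, hx, y, hy, hxy⟩ : ∃ x ∈ O a, ∃ y ∈ O a, parity x ≠ parity y := by
      rcases hcase with hc | ⟨x, hx, hxi⟩ | hc
      · have := Finset.card_filter_le (O a) fun x => x i = s a i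
        omega
      · exact absurd (hall x hx) hxi
      · exact hc
    -- A vertex with all neighbours in `Y` would be adjacent to every vertex of `Y`, contradicting
    -- the two different parities.
    have hnbr : ∀ u, ∃ n, (cubeGraph m).Adj u n ∧ n ∉ Y := by
      by_contra! hu
      obtain ⟨u, hu⟩ := hu
      have hpar : ∀ x ∈ O a, parity x = (if s a i then 1 else 0) + (parity u + 1) := fun x hx => by
        have : prj i x ∈ Y := by rwa [hYmem, ins_prj (hall x hx)]
        rw [parity_eq i, hall x hx,
          parity_adj (adj_of_mem_of_forall_adj (hY.trans hO') hu this)]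
      exact hxy ((hpar x hx).trans (hpar y hy).symm)
    obtain ⟨k, rfl⟩ : ∃ k, m = k + 1 := ⟨m - 1, by omega⟩
    exact joinedIn_compl' (by omega) Y (hY.trans hO') hsY htY (hnbr _) (hnbr _)
  by_cases hmono : ∃ a, ∃ x ∈ O a, ∃ y ∈ O a, parity x ≠ parity y
  · obtain ⟨a, ha⟩ := hmono
    obtain ⟨i, hi⟩ := bondy a
    exact step a i hi (.inr (.inr ha))
  by_cases hc : Fintype.card ι ≤ 2
  · obtain ⟨i, hi⟩ := bondy a₀
    exact step a₀ i hi (.inl ((hOcard a₀).trans (by omega)))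
  push Not at hmono hc
  have hpar : ∀ p q : ι ⊕ ι, parity (Sum.elim s t p) = parity (Sum.elim s t q) := by
    intro p q
    set base : ι ⊕ ι → ι := Sum.elim id id with hbase
    -- Two terminals belong to at most two pairs, so with at least three pairs both lie in `O a` for
    -- some third pair `a`.
    obtain ⟨a, ha⟩ : ∃ a, a ∉ ({base p, base q} : Finset ι) := by
      by_contra! h
      have h1 := Finset.card_le_card (s := Finset.univ) fun z _ => h z
      have h2 := h1.trans Finset.card_le_two
      rw [Finset.card_univ] at h2
      omega
    simp only [Finset.mem_insert, Finset.mem_singleton, not_or] at ha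
    have hO'' : ∀ p, a ≠ base p → Sum.elim s t p ∈ O a := by
      rintro (j | j) hj
      exacts [(hOmem a _).2 ⟨j, hj.symm, .inl rfl⟩, (hOmem a _).2 ⟨j, hj.symm, .inr rfl⟩]
    exact hmono a _ (hO'' p ha.1) _ (hO'' q ha.2)
  obtain ⟨j, hj⟩ := Fintype.exists_ne_of_one_lt_card (by omega) a₀
  obtain ⟨i, hi⟩ := Function.ne_iff.1 (hne (.inl j) (.inl a₀) (by simpa))
  refine step a₀ i (fun p q _ _ hpq => ?_)
    (.inr (.inl ⟨s j, (hOmem a₀ _).2 ⟨j, hj, .inl rfl⟩, hi⟩))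
  by_contra hpq'
  exact parity_ne_of_prj_eq (hne p q hpq') hpq (hpar p q)

/-- The base case is 4 because `Linked 3` is false: two pairs alternating around a square of the
planar 3-cube graph cannot be linked. -/
theorem stronglyLinked_and_linked (hm : 4 ≤ m) : StronglyLinked m ∧ Linked m := by
  induction m, hm using Nat.le_induction with
  | base => exact ⟨stronglyLinked_four, linked_of_stronglyLinked stronglyLinked_four (by decide)⟩
  | succ m hm ih => exact ⟨stronglyLinked_succ ih.2, linked_succ hm ih.1⟩

end Cube

namespace Polytope

/-! ### Exposed faces, vertices and edges of a polytope. -/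

section Faces

variable {E : Type*} [NormedAddCommGroup E] [NormedSpace ℝ E]

open scoped Classical in
/-- The points of `S` maximising `ℓ`. -/
noncomputable def faceVerts (S : Finset E) (ℓ : StrongDual ℝ E) : Finset E :=
  S.filter fun v => ∀ u ∈ S, ℓ u ≤ ℓ v

/-- Each point of `S` is the unique maximiser on `S` of some functional, that is, `S` is the set of
vertices of its convex hull. -/
def IsVertexSet (S : Finset E) : Prop :=
  ∀ v ∈ S, ∃ ℓ : StrongDual ℝ E, ∀ u ∈ S, u ≠ v → ℓ u < ℓ v

variable {S T R : Finset E} {ℓ : StrongDual ℝ E} {v x : E}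

theorem mem_faceVerts : v ∈ faceVerts S ℓ ↔ v ∈ S ∧ ∀ u ∈ S, ℓ u ≤ ℓ v := by simp [faceVerts]

theorem faceVerts_subset : faceVerts S ℓ ⊆ S := fun _ h => (mem_faceVerts.1 h).1

theorem faceVerts_nonempty (hS : S.Nonempty) (ℓ : StrongDual ℝ E) : (faceVerts S ℓ).Nonempty := by
  obtain ⟨v, hv, h⟩ := S.exists_max_image ℓ hS
  exact ⟨v, mem_faceVerts.2 ⟨hv, h⟩⟩

theorem lt_of_notMem_faceVerts {u : E} (hv : v ∈ faceVerts S ℓ) (hu : u ∈ S)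
    (hu' : u ∉ faceVerts S ℓ) : ℓ u < ℓ v := by
  refine lt_of_not_ge fun h => hu' (mem_faceVerts.2 ⟨hu, fun w hw => ?_⟩)
  exact ((mem_faceVerts.1 hv).2 w hw).trans h

theorem eq_of_mem_faceVerts {u : E} (hv : v ∈ faceVerts S ℓ) (hu : u ∈ faceVerts S ℓ) :
    ℓ u = ℓ v :=
  le_antisymm ((mem_faceVerts.1 hv).2 u (mem_faceVerts.1 hu).1)
    ((mem_faceVerts.1 hu).2 v (mem_faceVerts.1 hv).1)

theorem IsVertexSet.mono (hS : IsVertexSet S) (h : T ⊆ S) : IsVertexSet T := fun v hv =>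
  (hS v (h hv)).imp fun _ hℓ u hu => hℓ u (h hu)

theorem le_of_mem_convexHull {c : ℝ} (h : ∀ u ∈ S, ℓ u ≤ c) (hx : x ∈ convexHull ℝ (S : Set E)) :
    ℓ x ≤ c :=
  convexHull_min (t := {x | ℓ x ≤ c}) h (convex_halfSpace_le ℓ.toLinearMap.isLinear c) hx

/-- A convex combination attaining the maximum gives weight zero to every non-maximiser. Faces are
thereby handled as finite sets of points. -/
theorem toExposed_convexHull (hS : S.Nonempty) (ℓ : StrongDual ℝ E) :
    ℓ.toExposed (convexHull ℝ (S : Set E)) = convexHull ℝ (faceVerts S ℓ : Set E) := by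
  refine Set.Subset.antisymm ?_ (convexHull_min ?_ ?_)
  · rintro x ⟨hx, hmax⟩
    obtain ⟨v, hv⟩ := faceVerts_nonempty hS ℓ
    have hvS := (mem_faceVerts.1 hv).2
    have hxv : ℓ x = ℓ v := le_antisymm (le_of_mem_convexHull hvS hx)
      (hmax v (subset_convexHull ℝ _ (mem_faceVerts.1 hv).1))
    obtain ⟨w, hw0, hw1, hwx⟩ := Finset.mem_convexHull'.1 hx
    have hsum : ∑ y ∈ S, w y * (ℓ v - ℓ y) = 0 := by
      simp only [mul_sub, Finset.sum_sub_distrib, ← Finset.sum_mul, hw1]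
      rw [← hxv, ← hwx, map_sum]
      simp
    have hzero : ∀ y ∈ S, y ∉ faceVerts S ℓ → w y = 0 := by
      intro y hy hy'
      have h1 := (Finset.sum_eq_zero_iff_of_nonneg fun y hy =>
        mul_nonneg (hw0 y hy) (sub_nonneg.2 (hvS y hy))).1 hsum y hy
      exact (mul_eq_zero.1 h1).resolve_right (sub_pos.2 (lt_of_notMem_faceVerts hv hy hy')).ne'
    refine Finset.mem_convexHull'.2 ⟨w, fun y hy => hw0 y (faceVerts_subset hy), ?_, ?_⟩
    · rw [← hw1]
      exact Finset.sum_subset faceVerts_subset hzero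
    · rw [← hwx]
      exact Finset.sum_subset faceVerts_subset fun y hy hy' => by rw [hzero y hy hy', zero_smul]
  · intro v hv
    obtain ⟨hvS, hmax⟩ := mem_faceVerts.1 hv
    exact ⟨subset_convexHull ℝ _ hvS, fun y hy => le_of_mem_convexHull hmax hy⟩
  · exact (ContinuousLinearMap.toExposed.isExposed).convex (convex_convexHull ℝ _)

theorem isExposed_faceVerts (hS : S.Nonempty) (ℓ : StrongDual ℝ E) :
    IsExposed ℝ (convexHull ℝ (S : Set E)) (convexHull ℝ (faceVerts S ℓ : Set E)) := by
  rw [← toExposed_convexHull hS]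
  exact ContinuousLinearMap.toExposed.isExposed

theorem exists_faceVerts_of_isExposed (hS : S.Nonempty) {B : Set E}
    (hB : IsExposed ℝ (convexHull ℝ (S : Set E)) B) (hne : B.Nonempty) :
    ∃ ℓ : StrongDual ℝ E, B = convexHull ℝ (faceVerts S ℓ : Set E) := by
  obtain ⟨ℓ, rfl⟩ := hB hne
  exact ⟨ℓ, toExposed_convexHull hS ℓ⟩

/-- A polytope is the convex hull of its vertices. -/
theorem exists_isVertexSet {P : Set E} (hP : IsPolytope P) :
    ∃ S : Finset E, P = convexHull ℝ (S : Set E) ∧ IsVertexSet S := by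
  classical
  obtain ⟨S, rfl⟩ := hP
  induction S using Finset.strongInduction with
  | H S ih =>
  by_cases hS : IsVertexSet S
  · exact ⟨S, rfl, hS⟩
  unfold IsVertexSet at hS
  push Not at hS
  obtain ⟨v, hv, hvS⟩ := hS
  have hmem : v ∈ convexHull ℝ (S.erase v : Set E) := by
    by_contra hcon
    obtain ⟨ℓ, c, h1, h2⟩ := geometric_hahn_banach_closed_point (convex_convexHull ℝ _)
      ((S.erase v).finite_toSet.isClosed_convexHull ℝ) hcon
    obtain ⟨u, hu, huv, h⟩ := hvS ℓ
    exact absurd (h1 u (subset_convexHull ℝ _ (by simp [hu, huv]))) (by linarith)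
  obtain ⟨T, hT, hT'⟩ := ih _ (Finset.erase_ssubset hv)
  refine ⟨T, ?_, hT'⟩
  rw [← hT]
  refine Set.Subset.antisymm (convexHull_min (fun u hu => ?_) (convex_convexHull ℝ _))
    (convexHull_mono (by simp))
  by_cases h : u = v
  · exact h ▸ hmem
  · exact subset_convexHull ℝ _ (Finset.mem_coe.2 (Finset.mem_erase.2 ⟨h, hu⟩))

theorem IsVertexSet.isExposed_singleton (hS : IsVertexSet S) (hv : v ∈ S) :
    IsExposed ℝ (convexHull ℝ (S : Set E)) {v} := by
  obtain ⟨ℓ, hℓ⟩ := hS v hv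
  have : faceVerts S ℓ = {v} := by
    ext u
    simp only [mem_faceVerts, Finset.mem_singleton]
    constructor
    · rintro ⟨hu, h⟩
      by_contra hne
      exact absurd (h v hv) (not_le.2 (hℓ u hu hne))
    · rintro rfl
      exact ⟨hv, fun w hw => (eq_or_ne w u).elim (fun h => h ▸ le_rfl) fun h => (hℓ w hw h).le⟩
  simpa [this] using isExposed_faceVerts ⟨v, hv⟩ ℓ

theorem IsVertexSet.exposedPoints_eq (hS : IsVertexSet S) :
    (convexHull ℝ (S : Set E)).exposedPoints ℝ = S :=
  Set.Subset.antisymm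
    (exposedPoints_subset_extremePoints.trans extremePoints_convexHull_subset)
    fun _ hv => mem_exposedPoints_iff_exposed_singleton.2 (hS.isExposed_singleton hv)

/-- Lexicographic positivity survives a small perturbation: the second functional only breaks the
ties of the first. -/
theorem eventually_pos {a b : ℝ} (h : 0 < a ∨ a = 0 ∧ 0 < b) :
    ∀ᶠ ε in nhdsWithin (0 : ℝ) (Set.Ioi 0), 0 < a + ε * b := by
  rcases h with h | ⟨rfl, hb⟩
  · have : Filter.Tendsto (fun ε : ℝ => a + ε * b) (nhdsWithin 0 (Set.Ioi 0)) (nhds a) := by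
      refine tendsto_nhdsWithin_of_tendsto_nhds ?_
      have : Continuous fun ε : ℝ => a + ε * b := by fun_prop
      simpa using this.tendsto 0
    exact this.eventually (lt_mem_nhds h)
  · filter_upwards [self_mem_nhdsWithin] with ε hε
    simpa using mul_pos hε hb

theorem eventually_ne {a b : ℝ} (h : b ≠ 0) :
    ∀ᶠ ε in nhdsWithin (0 : ℝ) (Set.Ioi 0), a + ε * b ≠ 0 := by
  rcases lt_trichotomy a 0 with ha | rfl | ha
  · filter_upwards [eventually_pos (a := -a) (b := -b) (.inl (by linarith))] with ε hε h
    linarith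
  · filter_upwards [self_mem_nhdsWithin] with ε hε
    simpa using ⟨ne_of_gt hε, h⟩
  · filter_upwards [eventually_pos (b := b) (.inl ha)] with ε hε using hε.ne'

/-- A face of a face is a face. -/
theorem exists_faceVerts_trans (S : Finset E) (ℓ m : StrongDual ℝ E) :
    ∃ ℓ' : StrongDual ℝ E, faceVerts S ℓ' = faceVerts (faceVerts S ℓ) m := by
  classical
  rcases S.eq_empty_or_nonempty with rfl | hS
  · exact ⟨ℓ, by simp [faceVerts]⟩
  obtain ⟨v, hv⟩ := faceVerts_nonempty (faceVerts_nonempty hS ℓ) m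
  have hvT := faceVerts_subset hv
  have h : ∀ᶠ ε in nhdsWithin (0 : ℝ) (Set.Ioi 0), ∀ u ∈ S \ faceVerts (faceVerts S ℓ) m,
      0 < (ℓ v - ℓ u) + ε * (m v - m u) := by
    rw [Filter.eventually_all_finset]
    intro u hu
    obtain ⟨hu, hu'⟩ := Finset.mem_sdiff.1 hu
    refine eventually_pos ?_
    by_cases huT : u ∈ faceVerts S ℓ
    · exact .inr ⟨sub_eq_zero.2 (eq_of_mem_faceVerts huT hvT),
        sub_pos.2 (lt_of_notMem_faceVerts hv huT hu')⟩
    · exact .inl (sub_pos.2 (lt_of_notMem_faceVerts hvT hu huT))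
  obtain ⟨ε, hε⟩ := h.exists
  have hlt : ∀ u ∈ S, u ∉ faceVerts (faceVerts S ℓ) m → (ℓ + ε • m) u < (ℓ + ε • m) v := by
    intro u hu hu'
    have := hε u (Finset.mem_sdiff.2 ⟨hu, hu'⟩)
    simp only [add_apply, smul_apply, smul_eq_mul]
    linarith
  have heq : ∀ u ∈ faceVerts (faceVerts S ℓ) m, (ℓ + ε • m) u = (ℓ + ε • m) v := by
    intro u hu
    simp [eq_of_mem_faceVerts hv hu, eq_of_mem_faceVerts hvT (faceVerts_subset hu)]
  refine ⟨ℓ + ε • m, ?_⟩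
  ext u
  rw [mem_faceVerts]
  constructor
  · rintro ⟨hu, h⟩
    by_contra hu'
    exact absurd (h v (faceVerts_subset hvT)) (not_le.2 (hlt u hu hu'))
  · intro hu
    refine ⟨faceVerts_subset (faceVerts_subset hu), fun w hw => ?_⟩
    rw [heq u hu]
    by_cases hw' : w ∈ faceVerts (faceVerts S ℓ) m
    · exact (heq w hw').le
    · exact (hlt w hw hw').le

variable [FiniteDimensional ℝ E]

/-- A functional can be perturbed to be non-zero on finitely many given non-zero vectors, while
staying positive where it was. -/
theorem exists_generic (ℓ : StrongDual ℝ E) (A B : Finset E) (hA : ∀ a ∈ A, 0 < ℓ a)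
    (hB : ∀ b ∈ B, b ≠ 0) :
    ∃ ℓ' : StrongDual ℝ E, (∀ a ∈ A, 0 < ℓ' a) ∧ ∀ b ∈ B, ℓ' b ≠ 0 := by
  obtain ⟨g, hg⟩ := Module.exists_dual_forall_apply_ne_zero (K := ℝ) (fun b : B => (b : E))
    fun b => hB b b.2
  have h1 : ∀ᶠ ε in nhdsWithin (0 : ℝ) (Set.Ioi 0), ∀ a ∈ A, 0 < ℓ a + ε * g a := by
    rw [Filter.eventually_all_finset]
    exact fun a ha => eventually_pos (.inl (hA a ha))
  have h2 : ∀ᶠ ε in nhdsWithin (0 : ℝ) (Set.Ioi 0), ∀ b ∈ B, ℓ b + ε * g b ≠ 0 := by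
    rw [Filter.eventually_all_finset]
    exact fun b hb => eventually_ne (hg ⟨b, hb⟩)
  obtain ⟨ε, h3, h4⟩ := (h1.and h2).exists
  exact ⟨ℓ + ε • LinearMap.toContinuousLinearMap g, by simpa using h3, by simpa using h4⟩

/-- Every vertex not maximising `h` lies on an edge along which `h` increases. -/
theorem IsVertexSet.exists_edge_gt (hS : IsVertexSet S) (hv : v ∈ S) (h : StrongDual ℝ E)
    (hh : ∃ u ∈ S, h v < h u) :
    ∃ w ∈ S, h v < h w ∧ ∃ m : StrongDual ℝ E, (faceVerts S m : Set E) = {v, w} := by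
  classical
  obtain ⟨ℓ₀, hℓ₀⟩ := hS v hv
  -- `ℓ` vanishes on `c w w'` exactly when `w` and `w'` have the same slope `(h u - h v) / (ℓ v - ℓ
  -- u)`. A generic `ℓ` therefore allows ties only when `c w w' = 0`.
  set c : E → E → E := fun w w' => (h w - h v) • (v - w') - (h w' - h v) • (v - w) with hc
  obtain ⟨ℓ, hA, hB⟩ := exists_generic ℓ₀ ((S.erase v).image fun u => v - u)
    (((S ×ˢ S).image fun p => c p.1 p.2).filter fun x => x ≠ 0)
    (by
      intro a ha
      obtain ⟨u, hu, rfl⟩ := Finset.mem_image.1 ha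
      obtain ⟨huv, hu⟩ := Finset.mem_erase.1 hu
      simpa using hℓ₀ u hu huv)
    (fun b hb => (Finset.mem_filter.1 hb).2)
  have hpos : ∀ u ∈ S, u ≠ v → 0 < ℓ v - ℓ u := fun u hu huv => by
    simpa using hA _ (Finset.mem_image_of_mem _ (Finset.mem_erase.2 ⟨huv, hu⟩))
  obtain ⟨u₀, hu₀, hu₀v⟩ := hh
  have hu₀ne : u₀ ≠ v := fun h => by simp [h] at hu₀v
  -- As in a pivot of the simplex method, `w` has the largest slope `r`, so `h + r • ℓ` is maximal
  -- at both `v` and `w`.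
  obtain ⟨w, hw, hwmax⟩ := (S.erase v).exists_max_image (fun u => (h u - h v) / (ℓ v - ℓ u))
    ⟨u₀, Finset.mem_erase.2 ⟨hu₀ne, hu₀⟩⟩
  obtain ⟨hwv, hw⟩ := Finset.mem_erase.1 hw
  set r := (h w - h v) / (ℓ v - ℓ w) with hr
  have hrpos : 0 < r := (div_pos (sub_pos.2 hu₀v) (hpos u₀ hu₀ hu₀ne)).trans_le
    (hwmax u₀ (Finset.mem_erase.2 ⟨hu₀ne, hu₀⟩))
  have hrw : h w - h v = r * (ℓ v - ℓ w) := by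
    rw [hr, div_mul_cancel₀ _ (hpos w hw hwv).ne']
  have hle : ∀ u ∈ S, (h + r • ℓ) u ≤ (h + r • ℓ) v := by
    intro u hu
    by_cases huv : u = v
    · rw [huv]
    have := (div_le_iff₀ (hpos u hu huv)).1 (hwmax u (Finset.mem_erase.2 ⟨huv, hu⟩))
    simp only [add_apply, smul_apply, smul_eq_mul]
    linarith
  refine ⟨w, hw, by have := mul_pos hrpos (hpos w hw hwv); linarith, h + r • ℓ, ?_⟩
  have hwv' : (h + r • ℓ) w = (h + r • ℓ) v := by
    simp only [add_apply, smul_apply, smul_eq_mul]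
    linarith
  have hvF : v ∈ faceVerts S (h + r • ℓ) := mem_faceVerts.2 ⟨hv, hle⟩
  have hwF : w ∈ faceVerts S (h + r • ℓ) := mem_faceVerts.2 ⟨hw, fun u hu => hwv' ▸ hle u hu⟩
  ext u
  simp only [Finset.mem_coe, Set.mem_insert_iff, Set.mem_singleton_iff]
  refine ⟨fun huF => ?_, by rintro (rfl | rfl) <;> assumption⟩
  by_contra! hne
  obtain ⟨huv, huw⟩ := hne
  have hu := faceVerts_subset huF
  have hru : h u - h v = r * (ℓ v - ℓ u) := by
    have := eq_of_mem_faceVerts hvF huF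
    simp only [add_apply, smul_apply, smul_eq_mul] at this
    linarith
  have hc0 : c w u = 0 := by
    by_contra hne
    refine hB (c w u) (Finset.mem_filter.2 ⟨Finset.mem_image.2 ⟨(w, u), by simp [hw, hu], rfl⟩,
      hne⟩) ?_
    simp only [hc, map_sub, map_smul, smul_eq_mul, hrw, hru]
    ring
  -- A third maximiser `u` would lie on the ray from `v` through `w`; the nearer of `u` and `w`
  -- would then not be a vertex.
  have hsmul : ∀ g : StrongDual ℝ E,
      (ℓ v - ℓ w) * (g v - g u) = (ℓ v - ℓ u) * (g v - g w) := by
    intro g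
    have h1 := congrArg g hc0
    simp only [hc, map_sub, map_smul, smul_eq_mul, hrw, hru, map_zero] at h1
    have h2 : r * ((ℓ v - ℓ w) * (g v - g u) - (ℓ v - ℓ u) * (g v - g w)) = 0 := by linarith
    linarith [(mul_eq_zero.1 h2).resolve_left hrpos.ne']
  have hpw := hpos w hw hwv
  have hpu := hpos u hu huv
  rcases le_total (ℓ v - ℓ w) (ℓ v - ℓ u) with hle | hle
  · obtain ⟨g, hg⟩ := hS w hw
    have h1 := hg u hu huw
    have h2 := hg v hv hwv.symm
    have h3 := hsmul g
    nlinarith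
  · obtain ⟨g, hg⟩ := hS u hu
    have h1 := hg w hw huw.symm
    have h2 := hg v hv huv.symm
    have h3 := hsmul g
    nlinarith

end Faces

/-! ### Connectivity of polytope graphs and existence of facets. -/

section GraphConnectivity

variable {E : Type*} [NormedAddCommGroup E] [NormedSpace ℝ E]
  {S : Finset E}

theorem adj_of_faceVerts_eq {v w : (convexHull ℝ (S : Set E)).exposedPoints ℝ} (hvw : v ≠ w)
    (hS : S.Nonempty) {m : StrongDual ℝ E} (hm : (faceVerts S m : Set E) = {(v : E), (w : E)}) :
    (graph (convexHull ℝ (S : Set E))).Adj v w := by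
  refine ⟨hvw, ?_⟩
  rw [← convexHull_pair, ← hm]
  exact isExposed_faceVerts hS m

theorem dim_convexHull (S : Set E) : dim (convexHull ℝ S) = Module.finrank ℝ (vectorSpan ℝ S) := by
  rw [dim, ← direction_affineSpan, affineSpan_convexHull, direction_affineSpan]

theorem finrank_vectorSpan_lt_card (T : Finset E) (hT : T.Nonempty) :
    Module.finrank ℝ (vectorSpan ℝ (T : Set E)) < T.card := by
  classical
  have h := finrank_vectorSpan_image_finset_le ℝ id T (n := T.card - 1)
    (by have := hT.card_pos; omega)
  have := hT.card_pos
  rw [Finset.image_id] at h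
  omega

theorem eq_of_vectorSpan {f : StrongDual ℝ E} {T : Set E}
    (hf : ∀ x ∈ vectorSpan ℝ T, f x = 0) {x y : E} (hx : x ∈ T) (hy : y ∈ T) : f x = f y := by
  have := hf _ (vsub_mem_vectorSpan ℝ hx hy)
  rwa [vsub_eq_sub, map_sub, sub_eq_zero] at this

theorem vectorSpan_le_ker {f : StrongDual ℝ E} {T : Set E}
    (h : ∀ x ∈ T, ∀ y ∈ T, f x = f y) : vectorSpan ℝ T ≤ LinearMap.ker f.toLinearMap := by
  rw [vectorSpan_def, Submodule.span_le]
  rintro _ ⟨x, hx, y, hy, rfl⟩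
  simp [h x hx y hy]

variable [FiniteDimensional ℝ E]

theorem IsVertexSet.exists_adj_gt (hS : IsVertexSet S)
    (v : (convexHull ℝ (S : Set E)).exposedPoints ℝ) (h : StrongDual ℝ E)
    (hh : ∃ u ∈ S, h v < h u) :
    ∃ w, (graph (convexHull ℝ (S : Set E))).Adj v w ∧ h v < h w := by
  obtain ⟨w, hw, hvw, m, hm⟩ :=
    hS.exists_edge_gt (by simpa [hS.exposedPoints_eq] using v.2) h hh
  have hw' : w ∈ (convexHull ℝ (S : Set E)).exposedPoints ℝ := by
    rw [hS.exposedPoints_eq]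
    exact hw
  refine ⟨⟨w, hw'⟩, adj_of_faceVerts_eq ?_ ⟨w, hw⟩ hm, hvw⟩
  intro h
  rw [h] at hvw
  exact lt_irrefl _ hvw

/-- The vertices in an open half-space induce a connected graph. -/
theorem IsVertexSet.joinedIn_gt (hS : IsVertexSet S) (f : StrongDual ℝ E) (c : ℝ)
    {x y : (convexHull ℝ (S : Set E)).exposedPoints ℝ} (hx : c < f x) (hy : c < f y) :
    (graph (convexHull ℝ (S : Set E))).JoinedIn {w | c < f w} x y := by
  classical
  have hmem : ∀ z : (convexHull ℝ (S : Set E)).exposedPoints ℝ, (z : E) ∈ S := fun z => by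
    simpa [hS.exposedPoints_eq] using z.2
  -- The perturbation `g` has a unique maximiser on `S` and still ranks vertices with `f > c` above
  -- the others, so climbing along `g` never leaves the half-space.
  obtain ⟨g, hA, hB⟩ := exists_generic f
    ((((S ×ˢ S).filter fun p => c < f p.1 ∧ f p.2 ≤ c)).image fun p => p.1 - p.2)
    (S.offDiag.image fun p => p.1 - p.2)
    (by
      simp only [Finset.mem_image, Finset.mem_filter, forall_exists_index, and_imp]
      rintro _ p - h1 h2 rfl
      rw [map_sub]
      linarith)
    (by
      simp only [Finset.mem_image, Finset.mem_offDiag, forall_exists_index, and_imp]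
      rintro _ p - - h rfl
      exact sub_ne_zero.2 h)
  have hgt : ∀ u ∈ S, ∀ w ∈ S, c < f u → f w ≤ c → g w < g u := by
    intro u hu w hw h1 h2
    have := hA (u - w) (Finset.mem_image.2 ⟨(u, w), by simp [hu, hw, h1, h2], rfl⟩)
    rw [map_sub] at this
    linarith
  have hinj : ∀ u ∈ S, ∀ w ∈ S, g u = g w → u = w := by
    intro u hu w hw h
    by_contra hne
    refine hB (u - w) (Finset.mem_image.2 ⟨(u, w), by simp [hu, hw, hne], rfl⟩) ?_
    rw [map_sub, h, sub_self]
  obtain ⟨M, hM, hmax⟩ := S.exists_max_image g ⟨x, hmem x⟩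
  have hM' : M ∈ (convexHull ℝ (S : Set E)).exposedPoints ℝ := by
    rw [hS.exposedPoints_eq]
    exact hM
  have climb : ∀ (n : ℕ) (v : (convexHull ℝ (S : Set E)).exposedPoints ℝ), c < f v →
      (S.filter fun u => g v < g u).card = n →
      (graph (convexHull ℝ (S : Set E))).JoinedIn {w | c < f w} v ⟨M, hM'⟩ := by
    intro n
    induction n using Nat.strong_induction_on with
    | _ n ih =>
    intro v hv hn
    by_cases hvM : (v : E) = M
    · obtain rfl : v = ⟨M, hM'⟩ := Subtype.ext hvM
      exact .refl hv
    have hlt : g v < g M :=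
      lt_of_le_of_ne (hmax v (hmem v)) fun h => hvM (hinj _ (hmem v) _ hM h)
    obtain ⟨w, hvw, hw⟩ := hS.exists_adj_gt v g ⟨M, hM, hlt⟩
    have hcw : c < f w := by
      by_contra! h
      exact absurd (hgt v (hmem v) w (hmem w) hv h) (not_lt.2 hw.le)
    refine (ih _ ?_ w hcw rfl).head hvw hv
    rw [← hn]
    refine Finset.card_lt_card (Finset.ssubset_iff_of_subset ?_ |>.2 ⟨w, ?_, ?_⟩)
    · intro u hu
      simp only [Finset.mem_filter] at hu ⊢
      exact ⟨hu.1, hw.trans hu.2⟩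
    · simp [hmem w, hw]
    · simp
  exact (climb _ x hx rfl).trans (climb _ y hy rfl).symm

/-- An end on the hyperplane `f = c` first moves along an increasing edge into the connected open
half-space. -/
theorem IsVertexSet.joinedIn_ge (hS : IsVertexSet S) (f : StrongDual ℝ E) (c : ℝ)
    (hc : ∃ u ∈ S, c < f u) {x y : (convexHull ℝ (S : Set E)).exposedPoints ℝ} (hx : c ≤ f x)
    (hy : c ≤ f y) :
    (graph (convexHull ℝ (S : Set E))).JoinedIn {w | c < f w ∨ w = x ∨ w = y} x y := by
  have up : ∀ v : (convexHull ℝ (S : Set E)).exposedPoints ℝ, c ≤ f v → v = x ∨ v = y →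
      ∃ w : (convexHull ℝ (S : Set E)).exposedPoints ℝ, c < f w ∧
        (graph (convexHull ℝ (S : Set E))).JoinedIn {w | c < f w ∨ w = x ∨ w = y} v w := by
    intro v hv hvxy
    rcases hv.lt_or_eq with h | h
    · exact ⟨v, h, .refl (.inl h)⟩
    · obtain ⟨w, hvw, hw⟩ := hS.exists_adj_gt v f (by simpa [← h] using hc)
      rw [← h] at hw
      exact ⟨w, hw, .of_adj hvw (.inr hvxy) (.inl hw)⟩
  obtain ⟨x', hx', hxx'⟩ := up x hx (.inl rfl)
  obtain ⟨y', hy', hyy'⟩ := up y hy (.inr rfl)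
  exact hxx'.trans (((hS.joinedIn_gt f c hx' hy').mono_set fun w hw => .inl hw).trans hyy'.symm)

theorem IsVertexSet.joinedIn_le (hS : IsVertexSet S) (f : StrongDual ℝ E) (c : ℝ)
    (hc : ∃ u ∈ S, f u < c) {x y : (convexHull ℝ (S : Set E)).exposedPoints ℝ} (hx : f x ≤ c)
    (hy : f y ≤ c) :
    (graph (convexHull ℝ (S : Set E))).JoinedIn {w | f w < c ∨ w = x ∨ w = y} x y := by
  have := hS.joinedIn_ge (-f) (-c) (by simpa using hc) (x := x) (y := y) (by simpa using hx)
    (by simpa using hy)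
  simpa using this

/-- A functional vanishing on a subspace `W` and not on a larger-dimensional one. -/
theorem exists_functional {W W' : Submodule ℝ E} (h : ¬ W' ≤ W) :
    ∃ f : StrongDual ℝ E, (∀ x ∈ W, f x = 0) ∧ ∃ x ∈ W', f x ≠ 0 := by
  obtain ⟨x, hx, hxW⟩ := SetLike.not_le_iff_exists.1 h
  obtain ⟨f, hfx, hf⟩ := Submodule.exists_le_ker_of_notMem hxW
  exact ⟨LinearMap.toContinuousLinearMap f, fun y hy => by simpa using hf hy, x, hx, by simpa⟩

/-- A functional constant on a set `T` of at most `dim` points and not on the whole polytope. -/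
theorem exists_constant_on (S T : Finset E) (hT : T.Nonempty)
    (hcard : T.card ≤ dim (convexHull ℝ (S : Set E))) :
    ∃ f : StrongDual ℝ E, (∀ x ∈ T, ∀ y ∈ T, f x = f y) ∧ ∃ x ∈ S, ∃ y ∈ S, f x ≠ f y := by
  rw [dim_convexHull] at hcard
  obtain ⟨f, hf, x, hx, hfx⟩ := exists_functional (W := vectorSpan ℝ (T : Set E))
    (W' := vectorSpan ℝ (S : Set E)) fun hle => by
      have := Submodule.finrank_mono hle
      have := finrank_vectorSpan_lt_card T hT
      omega
  refine ⟨f, fun x hx y hy => eq_of_vectorSpan hf hx hy, ?_⟩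
  by_contra! h
  exact hfx (vectorSpan_le_ker h hx)

/-- **Balinski's theorem**: the graph of a `d`-polytope stays connected when fewer than `d` vertices
are deleted. -/
theorem IsVertexSet.joinedIn_compl (hS : IsVertexSet S)
    (T : Finset ((convexHull ℝ (S : Set E)).exposedPoints ℝ))
    (hT : T.card < dim (convexHull ℝ (S : Set E)))
    {x y : (convexHull ℝ (S : Set E)).exposedPoints ℝ} (hx : x ∉ T) (hy : y ∉ T) :
    (graph (convexHull ℝ (S : Set E))).JoinedIn
      (T : Set ((convexHull ℝ (S : Set E)).exposedPoints ℝ))ᶜ x y := by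
  classical
  -- A hyperplane through `T` and `x` exists because these are at most `d` points. The walk then
  -- stays strictly on a side of it, except at its ends.
  obtain ⟨f, hf, u, hu, v, hv, huv⟩ := exists_constant_on S ((insert x T).image Subtype.val)
    ⟨x, by simp⟩ (by
      refine Finset.card_image_le.trans ((Finset.card_insert_le _ _).trans hT))
  have hfT : ∀ z ∈ T, f z = f x := fun z hz =>
    hf z (Finset.mem_image_of_mem _ (Finset.mem_insert_of_mem hz)) x
      (Finset.mem_image_of_mem _ (Finset.mem_insert_self _ _))
  have up : (∃ u ∈ S, f x < f u) → f x ≤ f y → (graph (convexHull ℝ (S : Set E))).JoinedIn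
      (T : Set ((convexHull ℝ (S : Set E)).exposedPoints ℝ))ᶜ x y := fun h h' => by
    refine (hS.joinedIn_ge f (f x) h le_rfl h').mono_set ?_
    rintro w (hw | rfl | rfl) hwT
    exacts [hw.ne' (hfT w hwT), hx hwT, hy hwT]
  have down : (∃ u ∈ S, f u < f x) → f y ≤ f x → (graph (convexHull ℝ (S : Set E))).JoinedIn
      (T : Set ((convexHull ℝ (S : Set E)).exposedPoints ℝ))ᶜ x y := fun h h' => by
    refine (hS.joinedIn_le f (f x) h le_rfl h').mono_set ?_
    rintro w (hw | rfl | rfl) hwT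
    exacts [hw.ne (hfT w hwT), hx hwT, hy hwT]
  have hyS : (y : E) ∈ S := by simpa [hS.exposedPoints_eq] using y.2
  rcases lt_trichotomy (f x) (f y) with h | h | h
  · exact up ⟨y, hyS, h⟩ h.le
  · by_cases hup : ∃ u ∈ S, f x < f u
    · exact up hup h.le
    · push Not at hup
      refine down ?_ h.ge
      rcases lt_or_gt_of_ne huv with h' | h'
      · exact ⟨u, hu, h'.trans_le (hup v hv)⟩
      · exact ⟨v, hv, h'.trans_le (hup u hu)⟩
  · exact down ⟨y, hyS, h⟩ h.le

/-- In a polytope of dimension at least `4`, any two disjoint pairs of vertices can be linked. -/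
theorem IsVertexSet.twoLinkable (hS : IsVertexSet S) (hd : 4 ≤ dim (convexHull ℝ (S : Set E)))
    {s₁ t₁ s₂ t₂ : (convexHull ℝ (S : Set E)).exposedPoints ℝ} (h12 : s₁ ≠ s₂) (h12' : s₁ ≠ t₂)
    (h21 : t₁ ≠ s₂) (h21' : t₁ ≠ t₂) :
    ∃ A B, (graph (convexHull ℝ (S : Set E))).JoinedIn A s₁ t₁ ∧
      (graph (convexHull ℝ (S : Set E))).JoinedIn B s₂ t₂ ∧ Disjoint A B := by
  classical
  have hsS : (s₁ : E) ∈ S := by simpa [hS.exposedPoints_eq] using s₁.2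
  -- A hyperplane through the centroid that does not contain all of `S` has vertices strictly on
  -- both sides. The pair of `t₂` uses the closed side containing `t₂`, the other pair the opposite
  -- one.
  set z : E := (S.card : ℝ)⁻¹ • ∑ u ∈ S, u with hz
  have hcard : (S.card : ℝ) ≠ 0 := by
    exact_mod_cast (Finset.card_pos.2 ⟨_, hsS⟩).ne'
  obtain ⟨f, hf, u, hu, v, hv, huv⟩ := exists_constant_on S {(s₁ : E), (t₁ : E), (s₂ : E), z}
    ⟨s₁, by simp⟩ (Finset.card_le_four.trans hd)
  have ht1 : f t₁ = f s₁ := hf _ (by simp) _ (by simp)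
  have hs2 : f s₂ = f s₁ := hf _ (by simp) _ (by simp)
  have hzs : f z = f s₁ := hf _ (by simp) _ (by simp)
  have hsum : ∑ u ∈ S, (f u - f s₁) = 0 := by
    rw [Finset.sum_sub_distrib, Finset.sum_const, nsmul_eq_mul, ← hzs, hz, map_smul, map_sum,
      smul_eq_mul, mul_inv_cancel_left₀ hcard, sub_self]
  have hnonconst : ¬ ∀ u ∈ S, f u - f s₁ = 0 := fun h => huv (by linarith [h u hu, h v hv])
  have hup : ∃ u ∈ S, f s₁ < f u := by
    by_contra! h
    exact hnonconst ((Finset.sum_eq_zero_iff_of_nonpos fun u hu => by linarith [h u hu]).1 hsum)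
  have hdown : ∃ u ∈ S, f u < f s₁ := by
    by_contra! h
    exact hnonconst ((Finset.sum_eq_zero_iff_of_nonneg fun u hu => by linarith [h u hu]).1 hsum)
  rcases le_total (f s₁) (f t₂) with h | h
  · refine ⟨_, _, hS.joinedIn_le f (f s₁) hdown le_rfl ht1.le,
      hS.joinedIn_ge f (f s₁) hup hs2.ge h, ?_⟩
    rw [Set.disjoint_left]
    rintro w (hw | rfl | rfl) (hw' | rfl | rfl)
    exacts [lt_asymm hw hw', hw.ne hs2, absurd h (not_le.2 hw), lt_irrefl _ hw', h12 rfl, h12' rfl,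
      hw'.ne' ht1, h21 rfl, h21' rfl]
  · refine ⟨_, _, hS.joinedIn_ge f (f s₁) hup le_rfl ht1.ge,
      hS.joinedIn_le f (f s₁) hdown hs2.le h, ?_⟩
    rw [Set.disjoint_left]
    rintro w (hw | rfl | rfl) (hw' | rfl | rfl)
    exacts [lt_asymm hw hw', hw.ne' hs2, absurd h (not_le.2 hw), lt_irrefl _ hw', h12 rfl, h12' rfl,
      hw'.ne ht1, h21 rfl, h21' rfl]

/-- A polytope of positive dimension has a facet. -/
theorem exists_facet (S : Finset E) (hd : 1 ≤ dim (convexHull ℝ (S : Set E))) :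
    ∃ f : StrongDual ℝ E, (faceVerts S f).Nonempty ∧
      dim (convexHull ℝ (faceVerts S f : Set E)) + 1 = dim (convexHull ℝ (S : Set E)) := by
  classical
  have hS : S.Nonempty := by
    by_contra h
    rw [Finset.not_nonempty_iff_eq_empty] at h
    simp [h, dim, vectorSpan_empty] at hd
  have hproper : ∃ f : StrongDual ℝ E, faceVerts S f ≠ S := by
    obtain ⟨v, hv⟩ := hS
    obtain ⟨f, -, x, hx, y, hy, hxy⟩ := exists_constant_on S {v} ⟨v, by simp⟩ (by simpa using hd)
    refine ⟨f, fun h => hxy ?_⟩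
    rw [← h] at hx hy
    exact eq_of_mem_faceVerts hy hx
  obtain ⟨F, hF, hmax⟩ := Set.Finite.exists_maximalFor (fun T : Finset E => T.card)
    {T | ∃ f : StrongDual ℝ E, faceVerts S f = T ∧ T ≠ S}
    ((Finset.finite_toSet S.powerset).subset (by
      rintro T ⟨f, rfl, -⟩
      simpa using faceVerts_subset)) (by
      obtain ⟨f, hf⟩ := hproper
      exact ⟨_, f, rfl, hf⟩)
  obtain ⟨f, rfl, hfS⟩ := hF
  refine ⟨f, faceVerts_nonempty hS f, ?_⟩
  obtain ⟨v, hv⟩ := faceVerts_nonempty hS f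
  obtain ⟨u, hu, huF⟩ : ∃ u ∈ S, u ∉ faceVerts S f := by
    by_contra! h
    exact hfS (Finset.Subset.antisymm faceVerts_subset h)
  have huv : f u < f v := lt_of_notMem_faceVerts hv hu huF
  rw [dim_convexHull, dim_convexHull]
  set W := vectorSpan ℝ (faceVerts S f : Set E) with hW
  set W' := vectorSpan ℝ (S : Set E) with hW'
  have hWW' : W ≤ W' := vectorSpan_mono ℝ (by exact_mod_cast faceVerts_subset)
  have huvW : u - v ∉ W := fun h => by
    have : f (u - v) = 0 := vectorSpan_le_ker (f := f) (T := (faceVerts S f : Set E))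
      (fun x hx y hy => eq_of_mem_faceVerts hy hx) h
    rw [map_sub] at this
    linarith
  have huvW' : u - v ∈ W' := vsub_mem_vectorSpan ℝ hu (faceVerts_subset hv)
  -- otherwise, rotating `f` about its face produces a larger proper face
  have hle : W' ≤ W ⊔ Submodule.span ℝ {u - v} := by
    by_contra hcon
    obtain ⟨g, hg, x, hx, hgx⟩ := exists_functional hcon
    have hgF : ∀ w ∈ faceVerts S f, g w = g v := fun w hw =>
      eq_of_vectorSpan (T := (faceVerts S f : Set E))
        (fun y hy => hg y (Submodule.mem_sup_left hy)) hw hv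
    have hguv : g u = g v := by
      have := hg (u - v) (Submodule.mem_sup_right (Submodule.mem_span_singleton_self _))
      rw [map_sub] at this
      linarith
    obtain ⟨w, hw, hgw⟩ : ∃ w ∈ S, g w ≠ g v := by
      by_contra! h
      exact hgx (vectorSpan_le_ker (f := g) (T := (S : Set E))
        (fun x hx y hy => (h x hx).trans (h y hy).symm) hx)
    obtain ⟨g, hgF, hguv, hgw⟩ : ∃ g : StrongDual ℝ E, (∀ w ∈ faceVerts S f, g w = g v) ∧
        g u = g v ∧ g v < g w := by
      rcases lt_or_gt_of_ne hgw with h | h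
      · exact ⟨-g, by simpa using hgF, by simpa using hguv, by simpa using h⟩
      · exact ⟨g, hgF, hguv, h⟩
    have hpos : ∀ y ∈ S \ faceVerts S f, 0 < f v - f y := fun y hy => by
      obtain ⟨hy, hyF⟩ := Finset.mem_sdiff.1 hy
      exact sub_pos.2 (lt_of_notMem_faceVerts hv hy hyF)
    -- `y` is a vertex that the supporting hyperplane first meets when rotated about the face. The
    -- point `u` stays off the new face because `g u = g v` while `f u < f v`.
    obtain ⟨y, hy, hymax⟩ := (S \ faceVerts S f).exists_max_image
      (fun y => (g y - g v) / (f v - f y)) ⟨u, Finset.mem_sdiff.2 ⟨hu, huF⟩⟩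
    set r := (g y - g v) / (f v - f y) with hr
    have hry : g y - g v = r * (f v - f y) := by
      rw [hr, div_mul_cancel₀ _ (hpos y hy).ne']
    have hwF : w ∉ faceVerts S f := fun h => hgw.ne' (hgF w h)
    have hrpos : 0 < r := (div_pos (sub_pos.2 hgw) (hpos w (Finset.mem_sdiff.2 ⟨hw, hwF⟩))).trans_le
      (hymax w (Finset.mem_sdiff.2 ⟨hw, hwF⟩))
    have hh : ∀ x, (g + r • f) x = g x + r * f x := fun x => by simp
    have hle : ∀ x ∈ S, (g + r • f) x ≤ (g + r • f) v := by
      intro x hx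
      rw [hh, hh]
      by_cases hxF : x ∈ faceVerts S f
      · rw [hgF x hxF, eq_of_mem_faceVerts hv hxF]
      · have hx' := Finset.mem_sdiff.2 ⟨hx, hxF⟩
        have := (div_le_iff₀ (hpos x hx')).1 (hymax x hx')
        linarith
    have hsub : faceVerts S f ⊂ faceVerts S (g + r • f) := by
      refine Finset.ssubset_iff_of_subset (fun x hx => ?_) |>.2 ⟨y, ?_, (Finset.mem_sdiff.1 hy).2⟩
      · refine mem_faceVerts.2 ⟨faceVerts_subset hx, fun z hz => (hle z hz).trans_eq ?_⟩
        rw [hh, hh, hgF x hx, eq_of_mem_faceVerts hv hx]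
      · refine mem_faceVerts.2 ⟨(Finset.mem_sdiff.1 hy).1, fun z hz => (hle z hz).trans_eq ?_⟩
        rw [hh, hh]
        linarith
    have hne : faceVerts S (g + r • f) ≠ S := fun h => by
      have h1 := eq_of_mem_faceVerts (h.symm ▸ faceVerts_subset hv) (h.symm ▸ hu :
        u ∈ faceVerts S (g + r • f))
      rw [hh, hh, hguv] at h1
      nlinarith
    exact absurd (hmax ⟨_, rfl, hne⟩ (Finset.card_le_card hsub.subset))
      (not_le.2 (Finset.card_lt_card hsub))
  refine le_antisymm ?_ ?_
  · exact Submodule.finrank_lt_finrank_of_lt (lt_of_le_of_ne hWW' fun h => huvW (h ▸ huvW'))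
  · refine (Submodule.finrank_mono hle).trans ((Submodule.finrank_add_le_finrank_add_finrank _ _
      ).trans (Nat.add_le_add_left (finrank_span_singleton
      (sub_ne_zero.2 fun h => huF (by rwa [h]))).le _))

end GraphConnectivity

/-! ### Faces of the cube, and transfer of its graph along a lattice isomorphism. -/

section CubeFaces

variable {m : ℕ}

/-- The vertex of the geometric cube with coordinates `p`. -/
def cubePoint (p : Fin m → Bool) : Fin m → ℝ := fun i => if p i then 1 else 0

/-- The face of the cube through `p` spanned by the directions in `J`. -/
def cubeFace (p : Fin m → Bool) (J : Set (Fin m)) : Set (Fin m → ℝ) :=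
  {x ∈ unitCube m | ∀ i ∉ J, x i = cubePoint p i}

theorem cubePoint_mem (p : Fin m → Bool) : cubePoint p ∈ unitCube m := by
  constructor <;> intro i <;> simp only [cubePoint] <;> split_ifs <;> simp

theorem cubePoint_mem_cubeFace (p : Fin m → Bool) (J : Set (Fin m)) :
    cubePoint p ∈ cubeFace p J := ⟨cubePoint_mem p, fun _ _ => rfl⟩

theorem cubePoint_injective : Function.Injective (cubePoint (m := m)) := fun p q h => by
  ext i
  have := congrFun h i
  simp only [cubePoint] at this
  cases hp : p i <;> cases hq : q i <;> simp_all

theorem cubeFace_empty (p : Fin m → Bool) : cubeFace p ∅ = {cubePoint p} := by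
  ext x
  constructor
  · rintro ⟨-, h⟩
    exact funext fun i => h i (Set.notMem_empty i)
  · rintro rfl
    exact cubePoint_mem_cubeFace p _

theorem isExposed_cubeFace (p : Fin m → Bool) (J : Set (Fin m)) :
    IsExposed ℝ (unitCube m) (cubeFace p J) := by
  classical
  intro _
  set c : Fin m → ℝ := fun i => if i ∈ J then 0 else if p i then 1 else -1 with hc
  set ℓ : StrongDual ℝ (Fin m → ℝ) := ∑ i, c i • ContinuousLinearMap.proj i with hℓ
  have hval : ∀ x, ℓ x = ∑ i, c i * x i := fun x => by simp [hℓ]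
  have hle : ∀ x ∈ unitCube m, ∀ i, c i * x i ≤ c i * cubePoint p i := by
    intro x hx i
    have h0 : 0 ≤ x i := hx.1 i
    have h1 : x i ≤ 1 := hx.2 i
    simp only [hc, cubePoint]
    split_ifs <;> simp [h0, h1]
  have heq : ∀ x : Fin m → ℝ, (∀ i, c i * x i = c i * cubePoint p i) ↔
      ∀ i ∉ J, x i = cubePoint p i := by
    intro x
    refine forall_congr' fun i => ?_
    simp only [hc]
    split_ifs with h1 h2 <;> simp [h1]
  refine ⟨ℓ, ?_⟩
  ext x
  simp only [cubeFace, Set.mem_ofPred_eq]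
  refine and_congr_right fun hx => ?_
  rw [← heq]
  constructor
  · intro h y hy
    rw [hval, hval, Finset.sum_congr rfl fun i _ => h i]
    exact Finset.sum_le_sum fun i _ => hle y hy i
  · intro h
    have h1 := h _ (cubePoint_mem p)
    rw [hval, hval] at h1
    have h2 := (Finset.sum_eq_sum_iff_of_le fun i _ => hle x hx i).1
      (le_antisymm (Finset.sum_le_sum fun i _ => hle x hx i) h1)
    exact fun i => h2 i (Finset.mem_univ i)

/-- A non-empty face inside an edge of the cube contains an end of the edge. -/
theorem cubePoint_mem_of_subset_edge {p q : Fin m → Bool} {j : Fin m}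
    (hq : q = Function.update p j (!p j)) {B : Set (Fin m → ℝ)} (hB : IsExposed ℝ (unitCube m) B)
    (hne : B.Nonempty) (hsub : B ⊆ cubeFace p {j}) : cubePoint p ∈ B ∨ cubePoint q ∈ B := by
  obtain ⟨x, hx⟩ := hne
  obtain ⟨hxc, hxp⟩ := hsub hx
  have hxq : ∀ i ≠ j, x i = cubePoint q i := fun i hi => by
    rw [hxp i (by simpa using hi), hq]
    simp [cubePoint, hi]
  have hpq : cubePoint q j = 1 - cubePoint p j := by
    rw [hq]
    cases h : p j <;> simp [cubePoint, h]
  by_cases h1 : x j = cubePoint p j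
  · left
    convert hx using 1
    ext i
    by_cases hi : i = j
    · rw [hi, h1]
    · exact (hxp i (by simpa using hi)).symm
  by_cases h2 : x j = cubePoint q j
  · right
    convert hx using 1
    ext i
    by_cases hi : i = j
    · rw [hi, h2]
    · exact (hxq i hi).symm
  left
  have h0 : 0 ≤ x j := hxc.1 j
  have h1' : x j ≤ 1 := hxc.2 j
  -- Here `x` is interior to the edge, and an exposed face is extreme, so it contains the ends as
  -- well.
  refine hB.isExtreme.left_mem_of_mem_openSegment (cubePoint_mem p) (cubePoint_mem q) hx ?_
  obtain ⟨a, ha0, ha1, hax⟩ : ∃ a : ℝ, 0 < a ∧ a < 1 ∧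
      x j = a * cubePoint p j + (1 - a) * cubePoint q j := by
    rw [hpq] at h2 ⊢
    cases h : p j
    · simp only [cubePoint, h] at h1 h2 ⊢
      refine ⟨1 - x j, ?_, ?_, by simp⟩
      · exact sub_pos.2 (lt_of_le_of_ne h1' (by simpa using h2))
      · exact sub_lt_self _ (lt_of_le_of_ne h0 (Ne.symm (by simpa using h1)))
    · simp only [cubePoint, h] at h1 h2 ⊢
      refine ⟨x j, ?_, ?_, by simp⟩
      · exact lt_of_le_of_ne h0 (Ne.symm (by simpa using h2))
      · exact lt_of_le_of_ne h1' (by simpa using h1)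
  refine ⟨a, 1 - a, ha0, by linarith, by ring, ?_⟩
  ext i
  by_cases hi : i = j
  · rw [hi, hax]
    simp
  · simp only [Pi.add_apply, Pi.smul_apply, smul_eq_mul, ← hxq i hi,
      ← hxp i (by simpa using hi : i ∉ ({j} : Set (Fin m)))]
    ring

variable {E E' : Type*} [NormedAddCommGroup E] [NormedSpace ℝ E] [NormedAddCommGroup E']
  [NormedSpace ℝ E']

/-- The empty face is the least element of the lattice, so a lattice isomorphism preserves
emptiness. -/
theorem nonempty_iff_not_forall_le {P : Set E} (a : FaceLattice P) :
    a.1.Nonempty ↔ ¬ ∀ b, a ≤ b := by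
  rw [Set.nonempty_iff_ne_empty, not_iff_not]
  constructor
  · intro h b
    rw [← Subtype.coe_le_coe, h]
    exact Set.empty_subset _
  · intro h
    exact Set.subset_empty_iff.1 (h ⟨∅, isExposed_empty⟩)

theorem nonempty_orderIso_iff {P : Set E} {Q : Set E'} (Φ : FaceLattice P ≃o FaceLattice Q)
    (a : FaceLattice P) : (Φ a).1.Nonempty ↔ a.1.Nonempty := by
  rw [nonempty_iff_not_forall_le, nonempty_iff_not_forall_le, not_iff_not]
  constructor
  · exact fun h b => Φ.le_iff_le.1 (h _)
  · exact fun h b => by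
      rw [← Φ.apply_symm_apply b, Φ.le_iff_le]
      exact h _

/-- The graph of a polytope combinatorially equivalent to a cube contains the graph of the cube. -/
theorem IsVertexSet.exists_cube_embedding {T : Finset E} (hT : IsVertexSet T) (hne : T.Nonempty)
    (h : CombEquiv (convexHull ℝ (T : Set E)) (unitCube m)) :
    ∃ φ : (Fin m → Bool) → E, Function.Injective φ ∧ (∀ p, φ p ∈ T) ∧
      ∀ p q, (cubeGraph m).Adj p q →
        ∃ ℓ : StrongDual ℝ E, (faceVerts T ℓ : Set E) = {φ p, φ q} := by
  obtain ⟨Φ⟩ := h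
  have hpt : ∀ p, IsExposed ℝ (unitCube m) {cubePoint p} := fun p =>
    cubeFace_empty p ▸ isExposed_cubeFace p ∅
  have hface : ∀ b : FaceLattice (unitCube m), b.1.Nonempty → ∃ ℓ : StrongDual ℝ E,
      (Φ.symm b).1 = convexHull ℝ (faceVerts T ℓ : Set E) := fun b hb =>
    exists_faceVerts_of_isExposed hne (Φ.symm b).2 ((nonempty_orderIso_iff Φ.symm b).2 hb)
  have hvert : ∀ p, ∃ v, ∃ hv : v ∈ T,
      Φ ⟨{v}, hT.isExposed_singleton hv⟩ = ⟨{cubePoint p}, hpt p⟩ := by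
    intro p
    obtain ⟨ℓ, hℓ⟩ := hface ⟨{cubePoint p}, hpt p⟩ ⟨_, rfl⟩
    obtain ⟨v, hv⟩ := faceVerts_nonempty hne ℓ
    refine ⟨v, faceVerts_subset hv, ?_⟩
    -- The image of a vertex of the corresponding face is a nonempty face inside a single point,
    -- hence that point.
    have hle : Φ ⟨{v}, hT.isExposed_singleton (faceVerts_subset hv)⟩ ≤
        ⟨{cubePoint p}, hpt p⟩ := by
      rw [← Φ.symm.le_iff_le, Φ.symm_apply_apply, ← Subtype.coe_le_coe, hℓ]
      exact Set.singleton_subset_iff.2 (subset_convexHull ℝ _ hv)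
    exact Subtype.ext (Set.Nonempty.subset_singleton_iff
      ((nonempty_orderIso_iff Φ _).2 ⟨v, Set.mem_singleton v⟩) |>.1 hle)
  choose φ hφT hφ using hvert
  refine ⟨φ, fun p q hpq => ?_, hφT, ?_⟩
  · have h1 := hφ p
    simp only [hpq] at h1
    have h2 := congrArg Subtype.val (h1.symm.trans (hφ q))
    exact cubePoint_injective (Set.singleton_injective h2)
  rintro p q ⟨j, hj⟩
  set e : FaceLattice (unitCube m) := ⟨cubeFace p {j}, isExposed_cubeFace p {j}⟩ with he
  obtain ⟨ℓ, hℓ⟩ := hface e ⟨_, cubePoint_mem_cubeFace p _⟩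
  have hq : cubePoint q ∈ cubeFace p {j} := ⟨cubePoint_mem q, fun i hi => by
    have : i ≠ j := by simpa using hi
    simp [hj, cubePoint, this]⟩
  have hmem : ∀ r, cubePoint r ∈ cubeFace p {j} → φ r ∈ faceVerts T ℓ := by
    intro r hr
    have h1 : (⟨{φ r}, hT.isExposed_singleton (hφT r)⟩ :
        FaceLattice (convexHull ℝ (T : Set E))) ≤ Φ.symm e := by
      rw [← Φ.le_iff_le, Φ.apply_symm_apply, hφ]
      exact Set.singleton_subset_iff.2 hr
    have h2 : φ r ∈ (Φ.symm e).1 := h1 rfl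
    rw [hℓ, ← toExposed_convexHull hne] at h2
    exact mem_faceVerts.2 ⟨hφT r, fun u hu => h2.2 u (subset_convexHull ℝ _ hu)⟩
  refine ⟨ℓ, Set.Subset.antisymm (fun r hr => ?_) ?_⟩
  · have hrT := faceVerts_subset hr
    set R : FaceLattice (convexHull ℝ (T : Set E)) := ⟨{r}, hT.isExposed_singleton hrT⟩ with hR
    have hle : Φ R ≤ e := by
      rw [← Φ.symm.le_iff_le, Φ.symm_apply_apply, ← Subtype.coe_le_coe, hℓ]
      exact Set.singleton_subset_iff.2 (subset_convexHull ℝ _ hr)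
    -- A vertex `r` of the face corresponding to an edge is sent to a nonempty face inside that
    -- edge. This contains an end of the edge, so `r` is one of the two vertices already known.
    have heq : ∀ u, cubePoint u ∈ (Φ R).1 → r = φ u := by
      intro u hu
      have h1 : Φ ⟨{φ u}, hT.isExposed_singleton (hφT u)⟩ ≤ Φ R := by
        rw [hφ]
        exact Set.singleton_subset_iff.2 hu
      exact (Φ.le_iff_le.1 h1 rfl : φ u = r).symm
    exact (cubePoint_mem_of_subset_edge hj (Φ R).2 ((nonempty_orderIso_iff Φ R).2 ⟨r, rfl⟩)
      hle).imp (heq p) (heq q)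
  · rintro _ (rfl | rfl)
    exacts [hmem p (cubePoint_mem_cubeFace p _), hmem q hq]

end CubeFaces

/-! ### Transfer of linkedness from a cubical facet to the polytope. -/

section Main

/-- If a graph stays connected when fewer than `2k` vertices are deleted and contains a `k`-linked
graph on at least `2k` vertices, then it is `k`-linked. -/
theorem linkable_of_embedding {V W : Type*} [Finite V] [Fintype W] {G : SimpleGraph V}
    {H : SimpleGraph W} {ψ : W → V} (hψinj : Function.Injective ψ)
    (hψadj : ∀ p q, H.Adj p q → G.Adj (ψ p) (ψ q)) {k : ℕ}
    (hlink : ∀ s t : Fin k → W, Function.Injective (Sum.elim s t) → H.Linkable Set.univ s t)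
    (hW : 2 * k ≤ Fintype.card W)
    (hconn : ∀ Y : Finset V, Y.card < 2 * k → ∀ x ∉ Y, ∀ y ∉ Y, G.JoinedIn (Y : Set V)ᶜ x y)
    {s t : Fin k → V} (hst : Function.Injective (Sum.elim s t)) :
    G.Linkable Set.univ s t := by
  classical
  rcases isEmpty_or_nonempty W with hW' | hW'
  · obtain rfl : k = 0 := by simpa using hW
    exact ⟨fun _ => ∅, fun _ => Set.subset_univ _, fun i => i.elim0, fun i => i.elim0⟩
  set X : Finset V := Finset.univ.image (Sum.elim s t) with hX
  have hXcard : X.card = 2 * k := by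
    rw [hX, Finset.card_image_of_injective _ hst]
    simp [two_mul]
  have hmenger : G.HasDisjointWalks (Set.range ψ) X (2 * k) := by
    refine hasDisjointWalks_of_separates _ _ _ fun Y hY => ?_
    by_contra! hlt
    obtain ⟨x, hx, hxY⟩ := Finset.exists_mem_notMem_of_card_lt_card (hXcard.symm ▸ hlt)
    obtain ⟨z, hz, hzY⟩ := Finset.exists_mem_notMem_of_card_lt_card
      (s := Y) (t := Finset.univ.image ψ) (by
        rw [Finset.card_image_of_injective _ hψinj]
        exact hlt.trans_le hW)
    obtain ⟨p, -, rfl⟩ := Finset.mem_image.1 hz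
    exact hY _ ⟨p, rfl⟩ x hx (hconn Y hlt _ hzY x hxY)
  obtain ⟨a, D, haD, hD⟩ := hmenger.indexed hXcard
  -- Each walk is stopped at its first vertex in the image of `W`, so that it meets the linking
  -- walks inside that image only at its own end.
  have htrim : ∀ x ∈ X, ∃ c, ∃ D' ⊆ D x, G.JoinedIn D' x (ψ c) ∧
      ∀ z ∈ D', z ∈ Set.range ψ → z = ψ c := by
    intro x hx
    obtain ⟨hax, hj⟩ := haD x hx
    rcases hj.symm.first_hit (Set.range ψ) with h | ⟨_, ⟨c, rfl⟩, D', hD', h, hone, -⟩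
    · exact absurd hax h.right_mem.2
    · exact ⟨c, D', hD', h, hone⟩
  choose! c D' hD' hjoin hone using htrim
  have hmemX : ∀ p, Sum.elim s t p ∈ X := fun p => Finset.mem_image_of_mem _ (Finset.mem_univ p)
  have hdisj : ∀ p q, p ≠ q → Disjoint (D' (Sum.elim s t p)) (D' (Sum.elim s t q)) :=
    fun p q hpq => (hD _ (hmemX p) _ (hmemX q) (hst.ne hpq)).mono (hD' _ (hmemX p))
      (hD' _ (hmemX q))
  obtain ⟨A, -, hA, hAd⟩ := hlink (c ∘ s) (c ∘ t) (by
    rw [← Sum.comp_elim]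
    intro p q hpq
    by_contra hne
    have hpq : c (Sum.elim s t p) = c (Sum.elim s t q) := hpq
    refine Set.disjoint_left.1 (hdisj p q hne) (hjoin _ (hmemX p)).right_mem ?_
    rw [hpq]
    exact (hjoin _ (hmemX q)).right_mem)
  set L : Fin k → Set V := fun i => D' (s i) ∪ D' (t i) ∪ ψ '' A i with hL
  have hcross : ∀ i j, i ≠ j → ∀ p : Fin k ⊕ Fin k, p = .inl i ∨ p = .inr i →
      Disjoint (D' (Sum.elim s t p)) (ψ '' A j) := by
    intro i j hij p hp
    rw [Set.disjoint_left]
    rintro _ hz ⟨u, hu, rfl⟩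
    have hu' := hψinj (hone _ (hmemX p) _ hz ⟨u, rfl⟩)
    refine Set.disjoint_left.1 (hAd hij) ?_ hu
    rw [hu']
    rcases hp with rfl | rfl
    exacts [(hA i).left_mem, (hA i).right_mem]
  refine ⟨L, fun _ => Set.subset_univ _, fun i => ?_, fun i j hij => ?_⟩
  · have h1 := (hjoin _ (hmemX (.inl i))).mono_set
      (show D' (s i) ⊆ L i from fun z hz => .inl (.inl hz))
    have h2 := (hjoin _ (hmemX (.inr i))).mono_set
      (show D' (t i) ⊆ L i from fun z hz => .inl (.inr hz))
    have h3 : G.JoinedIn (L i) (ψ (c (s i))) (ψ (c (t i))) :=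
      (hA i).map hψadj fun u hu => .inr ⟨u, hu, rfl⟩
    exact h1.trans (h3.trans h2.symm)
  · simp only [hL, Set.disjoint_union_left, Set.disjoint_union_right]
    refine ⟨⟨⟨⟨hdisj (.inl i) (.inl j) (by simpa), hdisj (.inr i) (.inl j) (by simp)⟩,
      (hcross j i hij.symm (.inl j) (.inl rfl)).symm⟩,
      ⟨hdisj (.inl i) (.inr j) (by simp), hdisj (.inr i) (.inr j) (by simpa)⟩,
      (hcross j i hij.symm (.inr j) (.inr rfl)).symm⟩,
      ⟨hcross i j hij (.inl i) (.inl rfl), hcross i j hij (.inr i) (.inr rfl)⟩,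
      Set.disjoint_image_iff hψinj |>.2 (hAd hij)⟩

variable {E : Type*} [NormedAddCommGroup E] [NormedSpace ℝ E] [FiniteDimensional ℝ E]
  {S : Finset E}

/-- Linking along a facet that is a cube. -/
theorem IsVertexSet.linkable_of_cubical_facet (hS : IsVertexSet S) {f : StrongDual ℝ E} {m k : ℕ}
    (hSne : S.Nonempty) (hf : CombEquiv (convexHull ℝ (faceVerts S f : Set E)) (unitCube m))
    (hm : Cube.Linked m) (hk : 2 * k ≤ m + 1)
    (hd : m + 1 ≤ dim (convexHull ℝ (S : Set E)))
    {s t : Fin k → (convexHull ℝ (S : Set E)).exposedPoints ℝ}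
    (hst : Function.Injective (Sum.elim s t)) :
    (graph (convexHull ℝ (S : Set E))).Linkable Set.univ s t := by
  classical
  obtain ⟨φ, hφinj, hφT, hφ⟩ :=
    (hS.mono faceVerts_subset).exists_cube_embedding (faceVerts_nonempty hSne f) hf
  have : Finite ((convexHull ℝ (S : Set E)).exposedPoints ℝ) := by
    rw [hS.exposedPoints_eq]
    exact S.finite_toSet
  set ψ : (Fin m → Bool) → (convexHull ℝ (S : Set E)).exposedPoints ℝ := fun p => ⟨φ p, by
    rw [hS.exposedPoints_eq]
    exact faceVerts_subset (hφT p)⟩ with hψ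
  have hψinj : Function.Injective ψ := fun p q h => hφinj (congrArg Subtype.val h)
  have hψadj : ∀ p q, (cubeGraph m).Adj p q →
      (graph (convexHull ℝ (S : Set E))).Adj (ψ p) (ψ q) := by
    intro p q hpq
    obtain ⟨ℓ, hℓ⟩ := hφ p q hpq
    obtain ⟨ℓ', hℓ'⟩ := exists_faceVerts_trans S f ℓ
    exact adj_of_faceVerts_eq (hψinj.ne hpq.ne) hSne (m := ℓ') (by rw [hℓ', hℓ])
  have hpow : m + 1 ≤ 2 ^ m := Nat.lt_two_pow_self
  exact linkable_of_embedding hψinj hψadj (fun s t h => hm (Fin k) s t h (by simpa using hk))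
    (by simpa using hk.trans hpow)
    (fun Y hY x hx y hy => hS.joinedIn_compl Y (by omega) hx hy) hst

end Main

end Polytope

theorem mainTheorem7 (d : ℕ) (hd : 1 ≤ d) (n : ℕ) (P : Set (EuclideanSpace ℝ (Fin n)))
    (hP : Polytope.IsCubicalPolytope d P) :
    (Polytope.graph P).IsLinked (d / 2) := by
  classical
  obtain ⟨S, rfl, hS⟩ := Polytope.exists_isVertexSet hP.isPolytope
  have hdim := hP.dim_eq
  have hSne : S.Nonempty := by simpa using hP.nonempty
  refine SimpleGraph.isLinked_of_linkable ?_ fun s t hst => ?_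
  · have := Polytope.finrank_vectorSpan_lt_card S hSne
    rw [← Polytope.dim_convexHull, hdim] at this
    rw [hS.exposedPoints_eq]
    simp only [SetLike.coe_sort_coe, ENat.card_eq_coe_fintype_card, Fintype.card_coe]
    exact_mod_cast (by omega)
  generalize hk : d / 2 = k at s t
  have hne : ∀ p q : Fin k ⊕ Fin k, p ≠ q → Sum.elim s t p ≠ Sum.elim s t q :=
    fun p q h => hst.ne h
  -- For `k ≥ 3` we have `d ≥ 6`, so the facet is a cube of dimension at least 5, within the range
  -- of `stronglyLinked_and_linked`; and `2k ≤ d` is the bound required by `Linked (d - 1)`.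
  obtain hk1 | rfl | hk3 : k ≤ 1 ∨ k = 2 ∨ 3 ≤ k := by omega
  · refine ⟨fun _ => Set.univ, fun _ => Set.subset_univ _, fun i => ?_, fun i j hij => ?_⟩
    · exact (hS.joinedIn_compl ∅ (by simp; omega) (by simp) (by simp)).mono_set (Set.subset_univ _)
    · exact absurd (Fin.ext (by omega)) hij
  · obtain ⟨A, B, hA, hB, hAB⟩ := hS.twoLinkable (by omega)
      (hne (.inl 0) (.inl 1) (by simp)) (hne (.inl 0) (.inr 1) (by simp))
      (hne (.inr 0) (.inl 1) (by simp)) (hne (.inr 0) (.inr 1) (by simp))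
    refine ⟨![A, B], fun _ => Set.subset_univ _, fun i => ?_, fun i j hij => ?_⟩
    · fin_cases i
      exacts [hA, hB]
    · fin_cases i <;> fin_cases j
      exacts [absurd rfl hij, hAB, hAB.symm, absurd rfl hij]
  · obtain ⟨f, hfne, hf⟩ := Polytope.exists_facet S (by omega)
    have hfacet := hP.cubical _ ⟨Polytope.isExposed_faceVerts hSne f, by simpa using hfne, hf⟩
    exact hS.linkable_of_cubical_facet hSne hfacet
      (Cube.stronglyLinked_and_linked (by omega)).2 (by omega) hf.le hst
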